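/- Conventions. Let $n\ge 1$. On $\mathbb{C}^{n+1}$ let $(z,w)=\sum_{i=1}^{n} z_i\bar w_i-z_{n+1}\bar w_{n+1}$, let $\mathbb{H}^{2n+1}_1=\{z:(z,z)=-1\}$ be the anti-de Sitter space and $\mathbb{CH}^n=\mathbb{H}^{2n+1}_1/\mathbb{S}^1$ the complex hyperbolic space, with the complex structure $J$ and the metric $\langle\cdot,\cdot\rangle$ (of constant holomorphic sectional curvature $-4$) that are induced by the Hopf projection $z\mapsto[z]$; let $\mathbb{CP}^{n}=\mathbb{S}^{2n+1}/\mathbb{S}^1$ carry the Fubini--Study metric of constant holomorphic sectional curvature $4$, induced in the same way by the standard Hermitian product. An immersion of a smooth manifold into a Kähler manifold of complex dimension equal to the real dimension of the manifold is Lagrangian if the Kähler form $\Omega(u,v)=\langle Ju,v\rangle$ pulls back to $0$, and minimal if its mean curvature vector vanishes. A horizontal lift of a map into $\mathbb{CP}^{n-1}$ (resp. $\mathbb{CH}^{n-1}$) is a smooth lift to $\mathbb{S}^{2n-1}$ (resp. $\mathbb{H}^{2n-1}_1$) whose derivatives in all directions are orthogonal, for the Hermitian product, to the complex line spanned by the lift.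 Let $N$ be a simply connected smooth manifold of dimension $n-1$, and let $\rho>0$. (a) Let $r:\mathbb{R}\to\mathbb{R}$ be a solution of $r''\sinh r\cosh r=(1-(r')^2)(\sinh^2 r+n\cosh^2 r)$, $r(0)=\rho$, $r'(0)=0$, and put $a=\cosh\rho\,\sinh^n\rho$. Let $\phi:N\to\mathbb{CP}^{n-1}$ be a minimal Lagrangian immersion, and let $\tilde\phi:N\to\mathbb{S}^{2n-1}$ be a horizontal lift of $\phi$. Then $\Phi:\mathbb{R}\times N\to\mathbb{CH}^n$, $$\Phi(s,x)=\Big[\Big(\sinh r(s)\,e^{i a\int_0^s\frac{dt}{\sinh^{n+1}r(t)}}\,\tilde\phi(x),\ \cosh r(s)\,e^{i a\int_0^s\frac{\tanh^2 r(t)\,dt}{\sinh^{n+1}r(t)}}\Big)\Big],$$ is a minimal Lagrangian immersion. (b) Let $r:\mathbb{R}\to\mathbb{R}$ be a solution of $r''\sinh r\cosh r=(1-(r')^2)(\cosh^2 r+n\sinh^2 r)$, $r(0)=\rho$, $r'(0)=0$, and put $a=\sinh\rho\,\cosh^n\rho$. Let $\psi:N\to\mathbb{CH}^{n-1}$ be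 a minimal Lagrangian immersion, and let $\tilde\psi:N\to\mathbb{H}^{2n-1}_1$ be a horizontal lift of $\psi$. Then $\Psi:\mathbb{R}\times N\to\mathbb{CH}^n$, $$\Psi(s,x)=\Big[\Big(\sinh r(s)\,e^{i a\int_0^s\frac{\coth^2 r(t)\,dt}{\cosh^{n+1}r(t)}},\ \cosh r(s)\,e^{i a\int_0^s\frac{dt}{\cosh^{n+1}r(t)}}\,\tilde\psi(x)\Big)\Big],$$ is a minimal Lagrangian immersion. (c) Let $r(s)=\rho\cosh^{1/(n+1)}((n+1)s)$, $A_k(s)=\int_0^s dt/r(t)^k$ and $a=\rho^{n+1}$. Let $\eta:N\to\mathbb{C}^{n-1}$ be a minimal Lagrangian immersion and let $f:N\to\mathbb{C}$ be a differentiable function with $\Re f=|\eta|^2$ and $v(\Im f)=2\langle\eta_*v,J\eta\rangle$ for every vector $v$ tangent to $N$. Then $\Upsilon:\mathbb{R}\times N\to\mathbb{CH}^n$, $$\Upsilon(s,x)=\Big[e^{iaA_{n+1}(s)}\Big(r(s)\eta(x),\ \tfrac{1+r(s)^2(f(x)-1-2iaA_{n+3}(s))}{2r(s)},\ \tfrac{1+r(s)^2(f(x)+1-2iaA_{n+3}(s))}{2r(s)}\Big)\Big],$$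 is a minimal Lagrangian immersion. -/

import Mathlib

open scoped Manifold ContDiff Topology ComplexConjugate

noncomputable section

namespace MinLag

/-! ### The Hopf fibrations, complex projective space and complex hyperbolic space -/

/-- `ℂⁿ` (its real norm is the Euclidean one). -/
abbrev CVec (n : ℕ) : Type := EuclideanSpace ℂ (Fin n)

/-- The Hermitian form `(z, w) = ∑_{i ≤ n} zᵢ w̄ᵢ + ε z_{n+1} w̄_{n+1}` on `ℂⁿ⁺¹`.
It is used with `ε = 1` (definite) and with `ε = -1` (signature `(n, 1)`). -/
def herm (ε : ℝ) {n : ℕ} (z w : CVec (n + 1)) : ℂ :=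
  ∑ i : Fin n, z i.castSucc * conj (w i.castSucc)
    + (ε : ℂ) * (z (Fin.last n) * conj (w (Fin.last n)))

/-- The quadric `(z, z) = ε`: the unit sphere `𝕊²ⁿ⁺¹` for `ε = 1`, the anti-de Sitter space
`ℍ₁²ⁿ⁺¹` for `ε = -1`. -/
def Quadric (ε : ℝ) (n : ℕ) : Type := {z : CVec (n + 1) // herm ε z z = (ε : ℂ)}

/-- Two points of the quadric are in the same orbit of the circle `𝕊¹` of unit scalars. -/
instance orbitSetoid (ε : ℝ) (n : ℕ) : Setoid (Quadric ε n) where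
  r z w := ∃ c : ℂ, ‖c‖ = 1 ∧ w.1 = c • z.1
  iseqv := by
    refine ⟨fun z => ⟨1, by simp, by simp⟩, ?_, ?_⟩
    · rintro z w ⟨c, hc, h⟩
      have hc0 : c ≠ 0 := by
        rintro rfl
        simp at hc
      exact ⟨c⁻¹, by simp [hc], by rw [h, smul_smul, inv_mul_cancel₀ hc0, one_smul]⟩
    · rintro z w v ⟨c, hc, h⟩ ⟨d, hd, h'⟩
      exact ⟨d * c, by simp [hc, hd], by rw [h', h, smul_smul]⟩

/-- The orbit space of the quadric under `𝕊¹`. -/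
def HopfBase (ε : ℝ) (n : ℕ) : Type := Quotient (orbitSetoid ε n)

/-- `ℂℙⁿ = 𝕊²ⁿ⁺¹ / 𝕊¹`. -/
abbrev CP (n : ℕ) : Type := HopfBase 1 n

/-- `ℂℍⁿ = ℍ₁²ⁿ⁺¹ / 𝕊¹`. -/
abbrev CH (n : ℕ) : Type := HopfBase (-1) n

/-- The Hopf projection `Π`, `z ↦ [z]`. -/
def hopf {ε : ℝ} {n : ℕ} (z : Quadric ε n) : HopfBase ε n := Quotient.mk (orbitSetoid ε n) z

/-! ### Affine charts and the submersion metric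

The complex structure of the orbit space is given by the affine charts `[z] ↦ (zᵢ / z_k)_{i ≠ k}`.
-/

/-- The domain `{[z] : z_k ≠ 0}` of the `k`-th affine chart. -/
def affineDomain {ε : ℝ} {n : ℕ} (k : Fin (n + 1)) : Set (HopfBase ε n) :=
  {p | ∃ z : Quadric ε n, hopf z = p ∧ z.1 k ≠ 0}

/-- The affine coordinates `(zᵢ / z_k)_{i ≠ k}` of `[z]`. -/
def affineCoord {ε : ℝ} {n : ℕ} (k : Fin (n + 1)) : HopfBase ε n → CVec n :=
  Quotient.lift (fun z : Quadric ε n => WithLp.toLp 2 (fun i => z.1 (k.succAbove i) / z.1 k)) (by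
    rintro z w ⟨c, hc, h⟩
    have hc0 : c ≠ 0 := by
      rintro rfl
      simp at hc
    ext i
    simp [h, mul_div_mul_left _ _ hc0])

/-- The vector of `ℂⁿ⁺¹` with `k`-th coordinate `a` and remaining coordinates `w`. -/
def insertCoord {n : ℕ} (k : Fin (n + 1)) (a : ℂ) (w : CVec n) : CVec (n + 1) :=
  WithLp.toLp 2 (Fin.insertNth (α := fun _ => ℂ) k a w)

/-- The component of `u` orthogonal to the complex line of `z`, with respect to the Hermitian form:
the horizontal part of `u` for the projection `z ↦ [z]`. -/
def horizontal (ε : ℝ) {n : ℕ} (z u : CVec (n + 1)) : CVec (n + 1) :=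
  u - (herm ε u z / herm ε z z) • z

/-- The metric `⟨u, v⟩` at the point with coordinates `w` in the `k`-th affine chart: the metric for
which the Hopf projection is a (pseudo-)Riemannian submersion, `Re (,)` being the metric of the
quadric. The point is `[z]` with `z = (w, 1)` (the `1` in the `k`-th place), `z / |(z,z)|^{1/2}` lies
on the quadric, and the tangent vector with coordinates `u` is the image of `(u, 0) / |(z,z)|^{1/2}`.
It is the Fubini-Study metric of holomorphic sectional curvature `4` for `ε = 1` and the Bergman
metric of holomorphic sectional curvature `-4` for `ε = -1`. -/
def chartMetric (ε : ℝ) {n : ℕ} (k : Fin (n + 1)) (w u v : CVec n) : ℝ :=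
  (herm ε (horizontal ε (insertCoord k 1 w) (insertCoord k 0 u))
      (horizontal ε (insertCoord k 1 w) (insertCoord k 0 v))).re
    / |(herm ε (insertCoord k 1 w) (insertCoord k 1 w)).re|

/-- The Euclidean metric of `ℂⁿ`, `⟨u, v⟩ = Re ∑ uᵢ v̄ᵢ`, at any point `w`. -/
def flatMetric {n : ℕ} (_w u v : CVec n) : ℝ := (∑ i : Fin n, u i * conj (v i)).re

/-! ### Minimal Lagrangian immersions, in holomorphic coordinates of a Kähler manifold -/

section Local

variable {n : ℕ}

/-- `⟨Γ_w(u, v), x⟩`, the Christoffel symbols of the metric `g`, by the Koszul formula. -/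
def christoffel (g : CVec n → CVec n → CVec n → ℝ) (w u v x : CVec n) : ℝ :=
  (fderiv ℝ (fun y => g y v x) w u + fderiv ℝ (fun y => g y u x) w v
    - fderiv ℝ (fun y => g y u v) w x) / 2

variable {E : Type*} [NormedAddCommGroup E] [NormedSpace ℝ E]

/-- `⟨σ(X, Y), ν⟩` for `ν` normal to the immersion `f` at `p`: the inner product of `ν` with the
covariant derivative `∇_X f_* Y = D²f(X, Y) + Γ(Df X, Df Y)`, for the Levi-Civita connection of `g`
and constant vector fields `X`, `Y`. -/
def secondFundamentalForm (g : CVec n → CVec n → CVec n → ℝ) (f : E → CVec n) (p : E) (X Y : E)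
    (ν : CVec n) : ℝ :=
  g (f p) (fderiv ℝ (fderiv ℝ f) p X Y) ν + christoffel g (f p) (fderiv ℝ f p X) (fderiv ℝ f p Y) ν

/-- `H = 0` at `p`: for every normal vector `ν`, the trace of `⟨σ(·, ·), ν⟩` with respect to the
induced metric, computed in any orthonormal frame, vanishes. -/
def MeanCurvatureVanishesAt (g : CVec n → CVec n → CVec n → ℝ) (f : E → CVec n) (p : E) : Prop :=
  ∀ e : Fin (Module.finrank ℝ E) → E,
    (∀ i j, g (f p) (fderiv ℝ f p (e i)) (fderiv ℝ f p (e j)) = if i = j then 1 else 0) →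
    ∀ ν : CVec n, (∀ X : E, g (f p) (fderiv ℝ f p X) ν = 0) →
      ∑ i, secondFundamentalForm g f p (e i) (e i) ν = 0

variable {H M : Type*} [TopologicalSpace H] [TopologicalSpace M] [ChartedSpace H M]

/-- At the point `x` of the (boundaryless) manifold `M`, the map `F`, written in holomorphic
coordinates in which the Kähler metric of the target is `g`, is a minimal Lagrangian immersion. The
Kähler form is `Ω(u, v) = ⟨J u, v⟩`, where `J` is multiplication by `i`. -/
structure IsMinimalLagrangianAt (I : ModelWithCorners ℝ E H)
    (g : CVec n → CVec n → CVec n → ℝ) (F : M → CVec n) (x : M) : Prop where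
  dim_eq : Module.finrank ℝ E = n
  smooth : ContMDiffAt I 𝓘(ℝ, CVec n) ∞ F x
  immersion : Function.Injective (fderiv ℝ (F ∘ (extChartAt I x).symm) (extChartAt I x x))
  lagrangian : ∀ X Y : E,
    g (F x) (Complex.I • fderiv ℝ (F ∘ (extChartAt I x).symm) (extChartAt I x x) X)
      (fderiv ℝ (F ∘ (extChartAt I x).symm) (extChartAt I x x) Y) = 0
  minimal : MeanCurvatureVanishesAt g (F ∘ (extChartAt I x).symm) (extChartAt I x x)

/-- `F` is a minimal Lagrangian immersion into `ℂⁿ`. -/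
def IsMinimalLagrangianFlat (I : ModelWithCorners ℝ E H) (F : M → CVec n) : Prop :=
  ∀ x, IsMinimalLagrangianAt I flatMetric F x

/-- `F` is a minimal Lagrangian immersion into `ℂℙⁿ` (`ε = 1`) or `ℂℍⁿ` (`ε = -1`): around every
point it is so in every affine chart whose domain contains the image of the point. -/
def IsMinimalLagrangian (I : ModelWithCorners ℝ E H) {ε : ℝ} (F : M → HopfBase ε n) : Prop :=
  ∀ x k, F x ∈ affineDomain k →
    (∀ᶠ y in 𝓝 x, F y ∈ affineDomain k) ∧
      IsMinimalLagrangianAt I (chartMetric ε k) (fun y => affineCoord k (F y)) x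

/-- `φ̃` is a horizontal lift of `φ` with respect to the Hopf projection. -/
structure IsHorizontalLift (I : ModelWithCorners ℝ E H) {ε : ℝ} (φl : M → Quadric ε n)
    (φ : M → HopfBase ε n) : Prop where
  smooth : ContMDiff I 𝓘(ℝ, CVec (n + 1)) ∞ (fun x => (φl x).1)
  lift : ∀ x, hopf (φl x) = φ x
  horizontal : ∀ (x : M) (v : TangentSpace I x),
    herm ε (mfderiv I 𝓘(ℝ, CVec (n + 1)) (fun x => (φl x).1) x v) (φl x).1 = 0

end Local

/-! ### The profile functions -/

/-- `r'' sinh r cosh r = (1 - (r')²)(sinh² r + n cosh² r)`, `r(0) = ρ`, `r'(0) = 0`. -/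
structure IsSphericalProfile (n : ℕ) (ρ : ℝ) (r : ℝ → ℝ) : Prop where
  differentiable : Differentiable ℝ r
  differentiable_deriv : Differentiable ℝ (deriv r)
  equation : ∀ s, deriv (deriv r) s * Real.sinh (r s) * Real.cosh (r s)
    = (1 - deriv r s ^ 2) * (Real.sinh (r s) ^ 2 + n * Real.cosh (r s) ^ 2)
  init : r 0 = ρ
  deriv_init : deriv r 0 = 0

/-- `r'' sinh r cosh r = (1 - (r')²)(cosh² r + n sinh² r)`, `r(0) = ρ`, `r'(0) = 0`. -/
structure IsHyperbolicProfile (n : ℕ) (ρ : ℝ) (r : ℝ → ℝ) : Prop where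
  differentiable : Differentiable ℝ r
  differentiable_deriv : Differentiable ℝ (deriv r)
  equation : ∀ s, deriv (deriv r) s * Real.sinh (r s) * Real.cosh (r s)
    = (1 - deriv r s ^ 2) * (Real.cosh (r s) ^ 2 + n * Real.sinh (r s) ^ 2)
  init : r 0 = ρ
  deriv_init : deriv r 0 = 0

/-- `r(s) = ρ cosh^{1/(n+1)}((n+1)s)`. -/
def horosphericalProfile (n : ℕ) (ρ s : ℝ) : ℝ :=
  ρ * Real.cosh ((n + 1) * s) ^ (1 / ((n : ℝ) + 1))

theorem horosphericalProfile_pos (n : ℕ) {ρ : ℝ} (hρ : 0 < ρ) (s : ℝ) :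
    0 < horosphericalProfile n ρ s :=
  mul_pos hρ (Real.rpow_pos_of_pos (Real.cosh_pos _) _)

/-! ### The maps `Φ`, `Ψ`, `Υ`, where `n = m + 1` -/

/-- `(z, a)`. -/
def snocCoord {n : ℕ} (z : CVec n) (a : ℂ) : CVec (n + 1) :=
  WithLp.toLp 2 (Fin.snoc (α := fun _ => ℂ) z a)

/-- `(a, z)`. -/
def consCoord {n : ℕ} (a : ℂ) (z : CVec n) : CVec (n + 1) :=
  WithLp.toLp 2 (Fin.cons (α := fun _ => ℂ) a z)

theorem herm_snocCoord {n : ℕ} (ε : ℝ) (z w : CVec n) (a b : ℂ) :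
    herm ε (snocCoord z a) (snocCoord w b) = ∑ i, z i * conj (w i) + ε * (a * conj b) := by
  simp [herm, snocCoord]

theorem herm_consCoord {n : ℕ} (ε : ℝ) (z w : CVec (n + 1)) (a b : ℂ) :
    herm ε (consCoord a z) (consCoord b w) = a * conj b + herm ε z w := by
  simp [herm, consCoord, Fin.sum_univ_succ, ← Fin.succ_last, add_assoc]

theorem herm_smul_smul {n : ℕ} (ε : ℝ) (z w : CVec (n + 1)) (a b : ℂ) :
    herm ε (a • z) (b • w) = a * conj b * herm ε z w := by
  simp only [herm, PiLp.smul_apply, smul_eq_mul, map_mul, mul_add, Finset.mul_sum]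
  congr 1
  · exact Finset.sum_congr rfl fun i _ => by ring
  · ring

theorem expI_mul_conj (x : ℝ) :
    Complex.exp (x * Complex.I) * conj (Complex.exp (x * Complex.I)) = 1 := by
  rw [Complex.mul_conj, Complex.normSq_eq_norm_sq, Complex.norm_exp_ofReal_mul_I]
  simp

theorem cosh_sq_ofReal (x : ℝ) : ((Real.cosh x : ℝ) : ℂ) ^ 2 = ((Real.sinh x : ℝ) : ℂ) ^ 2 + 1 := by
  exact_mod_cast Real.cosh_sq x

/-- The vector
`(sinh r(s) e^{i a ∫₀ˢ dt/sinhⁿ⁺¹ r} z, cosh r(s) e^{i a ∫₀ˢ tanh² r dt/sinhⁿ⁺¹ r})`,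
where `a = cosh ρ sinhⁿ ρ`. -/
def PhiVec (m : ℕ) (ρ : ℝ) (r : ℝ → ℝ) (s : ℝ) (z : CVec (m + 1)) : CVec (m + 2) :=
  snocCoord
    ((Real.sinh (r s) * Complex.exp
      ((Real.cosh ρ * Real.sinh ρ ^ (m + 1) * ∫ t in (0 : ℝ)..s, 1 / Real.sinh (r t) ^ (m + 2) : ℝ)
        * Complex.I)) • z)
    (Real.cosh (r s) * Complex.exp
      ((Real.cosh ρ * Real.sinh ρ ^ (m + 1) *
        ∫ t in (0 : ℝ)..s, Real.tanh (r t) ^ 2 / Real.sinh (r t) ^ (m + 2) : ℝ) * Complex.I))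

theorem PhiVec_mem (m : ℕ) (ρ : ℝ) (r : ℝ → ℝ) (s : ℝ) (z : Quadric 1 m) :
    herm (-1) (PhiVec m ρ r s z.1) (PhiVec m ρ r s z.1) = ((-1 : ℝ) : ℂ) := by
  obtain ⟨z, hz⟩ := z
  have hz' : ∑ i, z i * conj (z i) = 1 := by
    rw [Fin.sum_univ_castSucc]
    simpa [herm] using hz
  unfold PhiVec
  rw [herm_snocCoord]
  generalize (Real.cosh ρ * Real.sinh ρ ^ (m + 1) *
    ∫ t in (0 : ℝ)..s, 1 / Real.sinh (r t) ^ (m + 2) : ℝ) = A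
  generalize (Real.cosh ρ * Real.sinh ρ ^ (m + 1) *
    ∫ t in (0 : ℝ)..s, Real.tanh (r t) ^ 2 / Real.sinh (r t) ^ (m + 2) : ℝ) = B
  have hA := expI_mul_conj A
  have hB := expI_mul_conj B
  have h := cosh_sq_ofReal (r s)
  have e : ∀ i, ((Real.sinh (r s) * Complex.exp (A * Complex.I)) • z) i
      * conj (((Real.sinh (r s) * Complex.exp (A * Complex.I)) • z) i)
      = (Real.sinh (r s) : ℂ) ^ 2 * (z i * conj (z i)) := by
    intro i
    simp only [PiLp.smul_apply, smul_eq_mul, map_mul, Complex.conj_ofReal]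
    linear_combination (Real.sinh (r s) : ℂ) ^ 2 * (z i * conj (z i)) * hA
  rw [Finset.sum_congr rfl fun i _ => e i, ← Finset.mul_sum, hz']
  simp only [map_mul, Complex.conj_ofReal]
  push_cast at h ⊢
  linear_combination (-(Complex.cosh (r s)) ^ 2) * hB - h

/-- `Φ : ℝ × N → ℂℍⁿ`. -/
def Phi {N : Type*} (m : ℕ) (ρ : ℝ) (r : ℝ → ℝ) (φl : N → Quadric 1 m) (p : ℝ × N) : CH (m + 1) :=
  hopf ⟨PhiVec m ρ r p.1 (φl p.2).1, PhiVec_mem m ρ r p.1 (φl p.2)⟩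

/-- The vector
`(sinh r(s) e^{i a ∫₀ˢ coth² r dt/coshⁿ⁺¹ r}, cosh r(s) e^{i a ∫₀ˢ dt/coshⁿ⁺¹ r} z)`,
where `a = sinh ρ coshⁿ ρ`. -/
def PsiVec (m : ℕ) (ρ : ℝ) (r : ℝ → ℝ) (s : ℝ) (z : CVec (m + 1)) : CVec (m + 2) :=
  consCoord
    (Real.sinh (r s) * Complex.exp
      ((Real.sinh ρ * Real.cosh ρ ^ (m + 1) * ∫ t in (0 : ℝ)..s,
        (Real.cosh (r t) / Real.sinh (r t)) ^ 2 / Real.cosh (r t) ^ (m + 2) : ℝ) * Complex.I))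
    ((Real.cosh (r s) * Complex.exp
      ((Real.sinh ρ * Real.cosh ρ ^ (m + 1) *
        ∫ t in (0 : ℝ)..s, 1 / Real.cosh (r t) ^ (m + 2) : ℝ) * Complex.I)) • z)

theorem PsiVec_mem (m : ℕ) (ρ : ℝ) (r : ℝ → ℝ) (s : ℝ) (z : Quadric (-1) m) :
    herm (-1) (PsiVec m ρ r s z.1) (PsiVec m ρ r s z.1) = ((-1 : ℝ) : ℂ) := by
  obtain ⟨z, hz⟩ := z
  unfold PsiVec
  rw [herm_consCoord, herm_smul_smul, hz]
  generalize (Real.sinh ρ * Real.cosh ρ ^ (m + 1) * ∫ t in (0 : ℝ)..s,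
        (Real.cosh (r t) / Real.sinh (r t)) ^ 2 / Real.cosh (r t) ^ (m + 2) : ℝ) = A
  generalize (Real.sinh ρ * Real.cosh ρ ^ (m + 1) *
        ∫ t in (0 : ℝ)..s, 1 / Real.cosh (r t) ^ (m + 2) : ℝ) = B
  have hA := expI_mul_conj A
  have hB := expI_mul_conj B
  have h := cosh_sq_ofReal (r s)
  simp only [map_mul, Complex.conj_ofReal]
  push_cast at h ⊢
  linear_combination (Complex.sinh (r s)) ^ 2 * hA - (Complex.cosh (r s)) ^ 2 * hB - h

/-- `Ψ : ℝ × N → ℂℍⁿ`. -/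
def Psi {N : Type*} (m : ℕ) (ρ : ℝ) (r : ℝ → ℝ) (ψl : N → Quadric (-1) m) (p : ℝ × N) :
    CH (m + 1) :=
  hopf ⟨PsiVec m ρ r p.1 (ψl p.2).1, PsiVec_mem m ρ r p.1 (ψl p.2)⟩

/-- `A_k(s) = ∫₀ˢ dt / r(t)ᵏ` for `r(t) = ρ cosh^{1/(n+1)}((n+1)t)`. -/
def horosphericalIntegral (n : ℕ) (ρ : ℝ) (k : ℕ) (s : ℝ) : ℝ :=
  ∫ t in (0 : ℝ)..s, 1 / horosphericalProfile n ρ t ^ k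

/-- The vector `e^{i a A_{n+1}(s)} (r(s) η, (1 + r(s)² (w - 1 - 2 i a A_{n+3}(s))) / (2 r(s)),
(1 + r(s)² (w + 1 - 2 i a A_{n+3}(s))) / (2 r(s)))`, where `a = ρⁿ⁺¹`. -/
def UpsilonVec (m : ℕ) (ρ s : ℝ) (η : CVec m) (w : ℂ) : CVec (m + 2) :=
  Complex.exp ((ρ ^ (m + 2) * horosphericalIntegral (m + 1) ρ (m + 2) s : ℝ) * Complex.I) •
    snocCoord
      (snocCoord ((horosphericalProfile (m + 1) ρ s : ℂ) • η)
        ((1 + horosphericalProfile (m + 1) ρ s ^ 2 * (w - 1 - 2 * Complex.I *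
            (ρ ^ (m + 2) * horosphericalIntegral (m + 1) ρ (m + 4) s : ℝ)))
          / (2 * horosphericalProfile (m + 1) ρ s)))
      ((1 + horosphericalProfile (m + 1) ρ s ^ 2 * (w + 1 - 2 * Complex.I *
            (ρ ^ (m + 2) * horosphericalIntegral (m + 1) ρ (m + 4) s : ℝ)))
          / (2 * horosphericalProfile (m + 1) ρ s))

theorem UpsilonVec_mem (m : ℕ) {ρ : ℝ} (hρ : 0 < ρ) (s : ℝ) (η : CVec m) (w : ℂ)
    (hw : w.re = ‖η‖ ^ 2) :
    herm (-1) (UpsilonVec m ρ s η w) (UpsilonVec m ρ s η w) = ((-1 : ℝ) : ℂ) := by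
  unfold UpsilonVec
  rw [herm_smul_smul, expI_mul_conj, one_mul, herm_snocCoord, Fin.sum_univ_castSucc]
  have hr := horosphericalProfile_pos (m + 1) hρ s
  generalize (ρ ^ (m + 2) * horosphericalIntegral (m + 1) ρ (m + 4) s : ℝ) = A
  generalize horosphericalProfile (m + 1) ρ s = R at hr
  have hR : (R : ℂ) ≠ 0 := by exact_mod_cast hr.ne'
  have hη : ∑ i, η i * conj (η i) = (w + conj w) / 2 := by
    rw [Complex.add_conj, hw, EuclideanSpace.norm_sq_eq]
    push_cast
    rw [mul_div_cancel_left₀ _ (two_ne_zero)]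
    exact Finset.sum_congr rfl fun i _ => by rw [Complex.mul_conj, Complex.normSq_eq_norm_sq]; simp
  have e : ∀ i, ((R : ℂ) • η) i * conj (((R : ℂ) • η) i) = (R : ℂ) ^ 2 * (η i * conj (η i)) := by
    intro i
    simp only [PiLp.smul_apply, smul_eq_mul, map_mul, Complex.conj_ofReal]
    ring
  simp only [snocCoord, Fin.snoc_castSucc, Fin.snoc_last]
  rw [Finset.sum_congr rfl fun i _ => e i, ← Finset.mul_sum, hη]
  simp only [map_mul, map_add, map_sub, map_div₀, map_one, map_pow, Complex.conj_ofReal,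
    Complex.conj_I, map_ofNat]
  push_cast
  field_simp
  ring

/-- `Υ : ℝ × N → ℂℍⁿ`. -/
def Upsilon {N : Type*} (m : ℕ) {ρ : ℝ} (hρ : 0 < ρ) (η : N → CVec m) (f : N → ℂ)
    (hf : ∀ x, (f x).re = ‖η x‖ ^ 2) (p : ℝ × N) : CH (m + 1) :=
  hopf ⟨UpsilonVec m ρ p.1 (η p.2) (f p.2),
    UpsilonVec_mem m hρ p.1 (η p.2) (f p.2) (hf p.2)⟩

end MinLag

end

/-!
# Minimal Lagrangian immersions of `ℝ × N` into complex hyperbolic space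

All computations take place in `ℂⁿ⁺¹`. In the affine charts the Levi-Civita connection of the metric
for which the Hopf projection is a submersion is explicit and complex bilinear
(`christoffel_chartMetric`). Hence, if `G` is a horizontal lift of an immersion, the second fundamental
form of the immersion is the horizontal part of `D²G` (`secondFundamentalForm_eq`), and "minimal
Lagrangian" becomes a condition on the jet `(DG, D²G)`: there is a frame on which the Hermitian form is
the identity matrix, and the trace of `D²G` is orthogonal to all `J DG(Y)`. This is `IsMinimalJet`; that
the condition is also sufficient uses that a horizontal normal vector is `J` times a tangent vector, by
a count of dimensions (`exists_eq_sum_of_normal`).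

The three explicit maps lift the immersions horizontally. On `ℝ × N` their jets have a warped form:
`∂ₛ` is a unit vector orthogonal to `N`, the slice `{s} × N` is a homothetic copy of the given minimal
Lagrangian immersion, and its mean curvature points in the direction `J ∂ₛ`. So everything comes down
to one scalar equation, which says that the curvature of the `s`-curves in the direction `J ∂ₛ` cancels
the mean curvature of the slices (`isMinimalJet_prod`).

* For the immersions built from `ℂℙⁿ⁻¹` and `ℂℍⁿ⁻¹` the lift is, up to the order of the coordinates,
  `(u(s) z, v(s))` with `u = σ(r) e^{iα}`, `v = τ(r) e^{iβ}`, where `(σ, τ)` is `(sinh, cosh)` or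
  `(cosh, sinh)`. The first integral `(1 - (r')²) σ(r)²ⁿ τ(r)² = a²` of the equation for `r` shows that
  `σ(r) τ(r) ≠ 0`, that `r` is smooth and that the `s`-curves have unit speed; the equation itself then
  gives the scalar equation (`isProfileCurve_of_ode`, `isMinimalLagrangian_join`).
* For the immersions built from `ℂⁿ⁻¹` the lift is `(U z, U w + Y, U)` in null coordinates of the form.
  The two conditions on `f` say that `df = 2 (η_*, η)` (`fderiv_potential`), which makes `f` smooth and
  the lift horizontal along `N`; the conditions on `U` and `Y` hold because `(r e^{iθ})' = r χ e^{iθ}`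
  for the unit vector `χ = tanh((n+1)s) + i / cosh((n+1)s)` (`isHorosphericalCurve`,
  `horospherical_jet`).
-/

noncomputable section

namespace MinLag

/-! ### The Hermitian form -/

section HermitianForm

variable {n : ℕ} (ε : ℝ)

theorem herm_add_left (z z' w : CVec (n + 1)) : herm ε (z + z') w = herm ε z w + herm ε z' w := by
  simp only [herm, PiLp.add_apply, add_mul, Finset.sum_add_distrib]
  ring

theorem herm_add_right (z w w' : CVec (n + 1)) : herm ε z (w + w') = herm ε z w + herm ε z w' := by
  simp only [herm, PiLp.add_apply, map_add, mul_add, Finset.sum_add_distrib]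
  ring

theorem herm_smul_left (a : ℂ) (z w : CVec (n + 1)) : herm ε (a • z) w = a * herm ε z w := by
  simpa using herm_smul_smul ε z w a 1

theorem herm_smul_right (a : ℂ) (z w : CVec (n + 1)) : herm ε z (a • w) = conj a * herm ε z w := by
  simpa using herm_smul_smul ε z w 1 a

theorem herm_real_smul_left (a : ℝ) (z w : CVec (n + 1)) : herm ε (a • z) w = a * herm ε z w := by
  simpa using herm_smul_left ε (a : ℂ) z w

theorem herm_real_smul_right (a : ℝ) (z w : CVec (n + 1)) : herm ε z (a • w) = a * herm ε z w := by
  simpa using herm_smul_right ε (a : ℂ) z w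

theorem herm_neg_left (z w : CVec (n + 1)) : herm ε (-z) w = -herm ε z w := by
  simpa using herm_smul_left ε (-1) z w

theorem herm_neg_right (z w : CVec (n + 1)) : herm ε z (-w) = -herm ε z w := by
  simpa using herm_smul_right ε (-1) z w

theorem herm_sub_left (z z' w : CVec (n + 1)) : herm ε (z - z') w = herm ε z w - herm ε z' w := by
  rw [sub_eq_add_neg, herm_add_left, herm_neg_left, sub_eq_add_neg]

theorem herm_sub_right (z w w' : CVec (n + 1)) : herm ε z (w - w') = herm ε z w - herm ε z w' := by
  rw [sub_eq_add_neg, herm_add_right, herm_neg_right, sub_eq_add_neg]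

theorem herm_zero_left (w : CVec (n + 1)) : herm ε 0 w = 0 := by
  simpa using herm_smul_left ε 0 0 w

theorem conj_herm (z w : CVec (n + 1)) : conj (herm ε z w) = herm ε w z := by
  simp only [herm, map_add, map_sum, map_mul, Complex.conj_conj, Complex.conj_ofReal]
  congr 1
  · exact Finset.sum_congr rfl fun i _ => mul_comm _ _
  · ring

theorem herm_self_im (z : CVec (n + 1)) : (herm ε z z).im = 0 := by
  have h := congrArg Complex.im (conj_herm ε z z)
  rw [Complex.conj_im] at h
  linarith

theorem herm_self_eq_re (z : CVec (n + 1)) : herm ε z z = ((herm ε z z).re : ℂ) :=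
  Complex.ext (by simp) (by simp [herm_self_im])

theorem herm_sum_left {ι : Type*} (s : Finset ι) (z : ι → CVec (n + 1)) (w : CVec (n + 1)) :
    herm ε (∑ i ∈ s, z i) w = ∑ i ∈ s, herm ε (z i) w := by
  classical
  induction s using Finset.induction_on with
  | empty => simp [herm_zero_left]
  | insert i s hi ih => rw [Finset.sum_insert hi, Finset.sum_insert hi, herm_add_left, ih]

/-- The Hermitian form as a continuous `ℝ`-bilinear map. -/
def hermCLM (n : ℕ) : CVec (n + 1) →L[ℝ] CVec (n + 1) →L[ℝ] ℂ :=
  (LinearMap.mk₂ ℝ (herm ε) (herm_add_left ε)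
    (fun a z w => by rw [herm_real_smul_left, Complex.real_smul]) (herm_add_right ε)
    (fun a z w => by rw [herm_real_smul_right, Complex.real_smul])).toContinuousBilinearMap

@[simp]
theorem hermCLM_apply (z w : CVec (n + 1)) : hermCLM ε n z w = herm ε z w := rfl

theorem hasFDerivAt_herm {E : Type*} [NormedAddCommGroup E] [NormedSpace ℝ E]
    {a b : E → CVec (n + 1)} {a' b' : E →L[ℝ] CVec (n + 1)} {p : E} (ha : HasFDerivAt a a' p)
    (hb : HasFDerivAt b b' p) :
    HasFDerivAt (fun y => herm ε (a y) (b y))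
      ((hermCLM ε n).precompR E (a p) b' + (hermCLM ε n).precompL E a' (b p)) p :=
  (hermCLM ε n).hasFDerivAt_of_bilinear ha hb

theorem fderiv_herm {E : Type*} [NormedAddCommGroup E] [NormedSpace ℝ E]
    {a b : E → CVec (n + 1)} {p : E} (ha : DifferentiableAt ℝ a p) (hb : DifferentiableAt ℝ b p)
    (X : E) : fderiv ℝ (fun y => herm ε (a y) (b y)) p X =
      herm ε (fderiv ℝ a p X) (b p) + herm ε (a p) (fderiv ℝ b p X) := by
  rw [(hasFDerivAt_herm ε ha.hasFDerivAt hb.hasFDerivAt).fderiv]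
  simp [add_comm]

/-- The form is positive definite on the orthogonal complement of a point of the quadric; in the
signature `(n, 1)` this is the reversed Cauchy-Schwarz inequality. -/
theorem herm_self_pos {z u : CVec (n + 1)} (hε : ε = 1 ∨ ε = -1) (hz : herm ε z z = ε)
    (hu : herm ε u z = 0) (hu0 : u ≠ 0) : 0 < (herm ε u u).re := by
  have key : ∀ x : CVec (n + 1), (herm ε x x).re
      = ∑ i : Fin n, ‖x i.castSucc‖ ^ 2 + ε * ‖x (Fin.last n)‖ ^ 2 := by
    intro x
    simp only [herm, Complex.mul_conj, Complex.normSq_eq_norm_sq]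
    norm_cast
  have hne : 0 < ∑ i : Fin n, ‖u i.castSucc‖ ^ 2 + ‖u (Fin.last n)‖ ^ 2 := by
    rw [← Fin.sum_univ_castSucc (fun i => ‖u i‖ ^ 2), ← EuclideanSpace.norm_sq_eq]
    positivity
  rcases hε with rfl | rfl
  · rw [key, one_mul]
    exact hne
  · have h1 := congrArg Complex.re hz
    rw [key, Complex.ofReal_re] at h1
    have h2 : ‖u (Fin.last n)‖ * ‖z (Fin.last n)‖ ≤ ∑ i : Fin n, ‖u i.castSucc‖ * ‖z i.castSucc‖ := by
      have : u (Fin.last n) * conj (z (Fin.last n)) = ∑ i : Fin n, u i.castSucc * conj (z i.castSucc) := by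
        have := hu
        simp only [herm, Complex.ofReal_neg, Complex.ofReal_one] at this
        linear_combination -this
      calc _ = ‖u (Fin.last n) * conj (z (Fin.last n))‖ := by simp
        _ ≤ _ := by
          rw [this]
          refine (norm_sum_le _ _).trans (le_of_eq ?_)
          simp
    have h3 := Finset.sum_mul_sq_le_sq_mul_sq Finset.univ (fun i : Fin n => ‖u i.castSucc‖)
      (fun i : Fin n => ‖z i.castSucc‖)
    rw [key]
    set A := ∑ i : Fin n, ‖u i.castSucc‖ ^ 2
    set B := ∑ i : Fin n, ‖z i.castSucc‖ ^ 2
    set a := ‖u (Fin.last n)‖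
    set b := ‖z (Fin.last n)‖
    have hA : 0 ≤ A := Finset.sum_nonneg fun i _ => by positivity
    have hB : 0 ≤ B := Finset.sum_nonneg fun i _ => by positivity
    have h4 : (a * b) ^ 2 ≤ A * B := (pow_le_pow_left₀ (by positivity) h2 2).trans h3
    by_contra! hle
    have hb : b ^ 2 = B + 1 := by linarith
    nlinarith [mul_le_mul_of_nonneg_right (show A ≤ a ^ 2 by linarith) hB, sq_nonneg a]

end HermitianForm

/-! ### The connection of the submersion metric in affine coordinates -/

section AffineConnection

variable {n : ℕ} (ε : ℝ) (k : Fin (n + 1))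

theorem insertCoord_add (a b : ℂ) (u v : CVec n) :
    insertCoord k (a + b) (u + v) = insertCoord k a u + insertCoord k b v := by
  ext i
  induction i using Fin.succAboveCases k <;> simp [insertCoord]

theorem insertCoord_smul (c a : ℂ) (u : CVec n) :
    insertCoord k (c * a) (c • u) = c • insertCoord k a u := by
  ext i
  induction i using Fin.succAboveCases k <;> simp [insertCoord]

theorem insertCoord_one (w : CVec n) : insertCoord k 1 w = insertCoord k 1 0 + insertCoord k 0 w := by
  rw [← insertCoord_add]
  simp

/-- The inclusion of `ℂⁿ` in `ℂⁿ⁺¹` as the hyperplane of vectors with `k`-th coordinate `0`. -/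
def insertZero : CVec n →L[ℝ] CVec (n + 1) :=
  LinearMap.toContinuousLinearMap
    { toFun := insertCoord k 0
      map_add' := fun u v => by rw [← insertCoord_add, add_zero]
      map_smul' := fun c u => by
        have := insertCoord_smul k c 0 u
        rw [mul_zero] at this
        simpa using this }

theorem insertZero_apply (u : CVec n) : insertZero k u = insertCoord k 0 u := rfl

theorem insertZero_smul (c : ℂ) (u : CVec n) : insertZero k (c • u) = c • insertZero k u := by
  rw [insertZero_apply, insertZero_apply, ← insertCoord_smul, mul_zero]

theorem hasFDerivAt_insertCoord_one (w : CVec n) :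
    HasFDerivAt (insertCoord k 1) (insertZero k) w := by
  have h : insertCoord k 1 = fun w => insertCoord k 1 0 + insertZero k w :=
    funext fun w => insertCoord_one k w
  rw [h]
  exact (insertZero k).hasFDerivAt.const_add _

theorem herm_horizontal_base {z : CVec (n + 1)} (hz : herm ε z z ≠ 0) (u : CVec (n + 1)) :
    herm ε (horizontal ε z u) z = 0 := by
  rw [horizontal, herm_sub_left, herm_smul_left]
  field_simp
  ring

theorem herm_horizontal_horizontal {z : CVec (n + 1)} (hz : herm ε z z ≠ 0) (u v : CVec (n + 1)) :
    herm ε (horizontal ε z u) (horizontal ε z v) = herm ε u (horizontal ε z v) := by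
  have h := herm_horizontal_base ε hz v
  have h' : herm ε z (horizontal ε z v) = 0 := by rw [← conj_herm, h, map_zero]
  conv_lhs => rw [horizontal]
  rw [herm_sub_left, herm_smul_left, h', mul_zero, sub_zero]

theorem herm_horizontal_right (z u v : CVec (n + 1)) :
    herm ε u (horizontal ε z v) = herm ε u v - herm ε u z * herm ε z v / herm ε z z := by
  rw [horizontal, herm_sub_right, herm_smul_right, map_div₀, conj_herm, conj_herm]
  ring

theorem horizontal_smul_smul {c : ℂ} (hc : c ≠ 0) (z u : CVec (n + 1)) :
    horizontal ε (c • z) (c • u) = c • horizontal ε z u := by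
  have hc' : conj c ≠ 0 := by simpa using hc
  rw [horizontal, horizontal, herm_smul_smul, herm_smul_smul, smul_sub, smul_smul, smul_smul,
    mul_div_mul_left _ _ (mul_ne_zero hc hc'), mul_comm]

theorem chartMetric_eq {w : CVec n} (hw : herm ε (insertCoord k 1 w) (insertCoord k 1 w) ≠ 0)
    (u v : CVec n) :
    chartMetric ε k w u v
      = (herm ε (insertZero k u) (horizontal ε (insertCoord k 1 w) (insertZero k v))).re
        / |(herm ε (insertCoord k 1 w) (insertCoord k 1 w)).re| := by
  rw [← herm_horizontal_horizontal ε hw]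
  rfl

/-- The derivative of the metric coefficient `⟨u, v⟩` in the direction `x`. -/
theorem fderiv_chartMetric {w : CVec n}
    (hw : herm ε (insertCoord k 1 w) (insertCoord k 1 w) ≠ 0) (u v x : CVec n) :
    fderiv ℝ (fun y => chartMetric ε k y u v) w x =
      (let Z := insertCoord k 1 w
       let U := insertZero k u
       let V := insertZero k v
       let X := insertZero k x
       let q := (herm ε Z Z).re
       (-2 * (herm ε U V).re * (herm ε X Z).re / q
          - (herm ε U X * herm ε Z V + herm ε U Z * herm ε X V).re / q
          + 4 * (herm ε U Z * herm ε Z V).re * (herm ε X Z).re / q ^ 2) / |q|) := by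
  set q : CVec n → ℝ := fun y => (herm ε (insertCoord k 1 y) (insertCoord k 1 y)).re with hq
  have hq0 : q w ≠ 0 := fun h => hw (by rw [herm_self_eq_re]; simpa [hq] using h)
  have hZ := hasFDerivAt_insertCoord_one k w
  have hqd : HasFDerivAt q _ w := (Complex.reCLM.hasFDerivAt).comp w (hasFDerivAt_herm ε hZ hZ)
  have hs : ∀ᶠ y in 𝓝 w, q y ≠ 0 ∧ |q y| = (|q w| / q w) * q y := by
    rcases lt_or_gt_of_ne hq0 with h | h
    · filter_upwards [hqd.continuousAt.eventually (gt_mem_nhds h)] with y hy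
      refine ⟨hy.ne, ?_⟩
      rw [abs_of_neg hy, abs_of_neg h]
      field_simp
    · filter_upwards [hqd.continuousAt.eventually (lt_mem_nhds h)] with y hy
      refine ⟨hy.ne', ?_⟩
      rw [abs_of_pos hy, abs_of_pos h]
      field_simp
  have heq : (fun y => chartMetric ε k y u v) =ᶠ[𝓝 w] fun y =>
      (q w / |q w|) * ((herm ε (insertZero k u) (insertZero k v)).re * (q y)⁻¹
        - (herm ε (insertZero k u) (insertCoord k 1 y)
            * herm ε (insertCoord k 1 y) (insertZero k v)).re * (q y)⁻¹ ^ 2) := by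
    filter_upwards [hs] with y hy
    have hy0 : herm ε (insertCoord k 1 y) (insertCoord k 1 y) ≠ 0 := by
      intro h
      exact hy.1 (by simp [hq, h])
    rw [chartMetric_eq ε k hy0, herm_horizontal_right]
    change _ / |q y| = _
    rw [hy.2, herm_self_eq_re ε (insertCoord k 1 y)]
    change (_ - _ / ((q y : ℝ) : ℂ)).re / _ = _
    rw [Complex.sub_re, Complex.div_ofReal_re]
    have := hy.1
    have := abs_ne_zero.mpr hq0
    field_simp
  rw [heq.fderiv_eq]
  have hU := (hasFDerivAt_herm ε (hasFDerivAt_const (insertZero k u) w) hZ)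
  have hV := (hasFDerivAt_herm ε hZ (hasFDerivAt_const (insertZero k v) w))
  have hinv := (hasDerivAt_inv hq0).comp_hasFDerivAt w hqd
  have hP : HasFDerivAt (fun y => (herm ε (insertZero k u) (insertCoord k 1 y)
            * herm ε (insertCoord k 1 y) (insertZero k v)).re) _ w :=
    (Complex.reCLM.hasFDerivAt).comp w (hU.mul hV)
  have htot := ((hinv.const_mul (herm ε (insertZero k u) (insertZero k v)).re).sub
    (hP.mul (hinv.pow 2))).const_mul (q w / |q w|)
  have e := congrArg (fun L => L x) htot.fderiv
  refine Eq.trans e ?_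
  have hZX : (herm ε (insertCoord k 1 w) (insertZero k x)).re
      = (herm ε (insertZero k x) (insertCoord k 1 w)).re := by
    rw [← conj_herm, Complex.conj_re]
  have ha := abs_ne_zero.mpr hq0
  have hqw : (herm ε (insertCoord k 1 w) (insertCoord k 1 w)).re = q w := rfl
  simp [hZX, hqw]
  field_simp
  ring

/-- The Levi-Civita connection of the submersion metric is complex bilinear: at the point `[Z]`, in
affine coordinates, `Γ(u, v) = -((u, Z) v + (v, Z) u) / (Z, Z)`. -/
theorem christoffel_chartMetric {w : CVec n}
    (hw : herm ε (insertCoord k 1 w) (insertCoord k 1 w) ≠ 0) (u v x : CVec n) :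
    christoffel (chartMetric ε k) w u v x =
      -(herm ε (herm ε (insertZero k u) (insertCoord k 1 w) • insertZero k v
          + herm ε (insertZero k v) (insertCoord k 1 w) • insertZero k u)
        (horizontal ε (insertCoord k 1 w) (insertZero k x))
          / herm ε (insertCoord k 1 w) (insertCoord k 1 w)).re
        / |(herm ε (insertCoord k 1 w) (insertCoord k 1 w)).re| := by
  rw [christoffel, fderiv_chartMetric ε k hw, fderiv_chartMetric ε k hw, fderiv_chartMetric ε k hw]
  dsimp only
  generalize insertZero k u = U
  generalize insertZero k v = V
  generalize insertZero k x = X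
  generalize insertCoord k 1 w = Z at hw ⊢
  rw [herm_horizontal_right]
  have hq : (herm ε Z Z).re ≠ 0 := fun h => hw (by rw [herm_self_eq_re, h, Complex.ofReal_zero])
  have hZ := herm_self_eq_re ε Z
  generalize (herm ε Z Z).re = q at hq hZ ⊢
  rw [hZ]
  simp only [herm_add_left, herm_smul_left]
  rw [← conj_herm ε X Z, ← conj_herm ε V Z, ← conj_herm ε U V, ← conj_herm ε V X]
  generalize herm ε U V = a
  generalize herm ε U X = b
  generalize herm ε V X = c
  generalize herm ε U Z = d
  generalize herm ε V Z = e
  generalize herm ε X Z = f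
  have ha := abs_ne_zero.mpr hq
  simp only [Complex.div_ofReal_re, Complex.add_re, Complex.sub_re, Complex.mul_re,
    Complex.mul_im, Complex.conj_re, Complex.conj_im, Complex.add_im]
  field_simp
  ring

end AffineConnection

/-! ### Horizontal lifts: first and second order -/

section SecondDerivative

variable {E : Type*} [NormedAddCommGroup E] [NormedSpace ℝ E]

theorem differentiableAt_fderiv {F : Type*} [NormedAddCommGroup F] [NormedSpace ℝ F] {f : E → F}
    {p : E} (hf : ContDiffAt ℝ 2 f p) : DifferentiableAt ℝ (fderiv ℝ f) p :=
  (hf.fderiv_right (m := 1) (by norm_num)).differentiableAt (by norm_num)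

theorem eventually_differentiableAt {F : Type*} [NormedAddCommGroup F] [NormedSpace ℝ F]
    {f : E → F} {p : E} (hf : ContDiffAt ℝ 2 f p) : ∀ᶠ y in 𝓝 p, DifferentiableAt ℝ f y := by
  filter_upwards [hf.eventually (by simp)] with y hy
  exact hy.differentiableAt (by norm_num)

theorem fderiv_fderiv_apply {F : Type*} [NormedAddCommGroup F] [NormedSpace ℝ F] {f : E → F}
    {p : E} (hf : ContDiffAt ℝ 2 f p) (X Y : E) :
    fderiv ℝ (fderiv ℝ f) p X Y = fderiv ℝ (fun y => fderiv ℝ f y Y) p X := by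
  rw [fderiv_clm_apply (differentiableAt_fderiv hf) (differentiableAt_const _)]
  simp

theorem differentiableAt_fderiv_apply {F : Type*} [NormedAddCommGroup F] [NormedSpace ℝ F]
    {f : E → F} {p : E} (hf : ContDiffAt ℝ 2 f p) (Y : E) :
    DifferentiableAt ℝ (fun y => fderiv ℝ f y Y) p :=
  (differentiableAt_fderiv hf).clm_apply (differentiableAt_const _)

/-- The Leibniz rule for the second derivative of a product. -/
theorem fderiv_fderiv_bilinear {F₁ F₂ F : Type*} [NormedAddCommGroup F₁] [NormedSpace ℝ F₁]
    [NormedAddCommGroup F₂] [NormedSpace ℝ F₂] [NormedAddCommGroup F] [NormedSpace ℝ F]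
    (B : F₁ →L[ℝ] F₂ →L[ℝ] F) {f : E → F₁} {g : E → F₂} {p : E} (hf : ContDiffAt ℝ 2 f p)
    (hg : ContDiffAt ℝ 2 g p) (X Y : E) :
    fderiv ℝ (fderiv ℝ (fun y => B (f y) (g y))) p X Y =
      B (fderiv ℝ (fderiv ℝ f) p X Y) (g p) + B (fderiv ℝ f p X) (fderiv ℝ g p Y)
        + B (fderiv ℝ f p Y) (fderiv ℝ g p X) + B (f p) (fderiv ℝ (fderiv ℝ g) p X Y) := by
  have hB : ContDiffAt ℝ 2 (fun y => B (f y) (g y)) p :=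
    (B.contDiff.contDiffAt.comp p hf).clm_apply hg
  have h2 : (2 : ℕ∞ω) ≠ 0 := by norm_num
  rw [fderiv_fderiv_apply hB]
  have e : (fun y => fderiv ℝ (fun y => B (f y) (g y)) y Y) =ᶠ[𝓝 p]
      fun y => B (f y) (fderiv ℝ g y Y) + B (fderiv ℝ f y Y) (g y) := by
    filter_upwards [eventually_differentiableAt hf, eventually_differentiableAt hg] with y h1 h2
    rw [B.fderiv_of_bilinear h1 h2]
    rfl
  have d1 := B.hasFDerivAt_of_bilinear (hf.differentiableAt h2).hasFDerivAt
    (differentiableAt_fderiv_apply hg Y).hasFDerivAt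
  have d2 := B.hasFDerivAt_of_bilinear (differentiableAt_fderiv_apply hf Y).hasFDerivAt
    (hg.differentiableAt h2).hasFDerivAt
  rw [e.fderiv_eq, (d1.fun_add d2).fderiv, fderiv_fderiv_apply hf, fderiv_fderiv_apply hg]
  have eR : ∀ (a : F₁) (L : E →L[ℝ] F₂), B.precompR E a L X = B a (L X) := fun _ _ => rfl
  have eL : ∀ (L : E →L[ℝ] F₁) (b : F₂), B.precompL E L b X = B (L X) b := fun _ _ => rfl
  simp only [add_apply, eR, eL]
  abel

end SecondDerivative

section HorizontalLift

variable {n : ℕ}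

/-- The affine coordinates `(zᵢ / z_k)_{i ≠ k}` as a function on `ℂⁿ⁺¹`. -/
def affineMap (k : Fin (n + 1)) (z : CVec (n + 1)) : CVec n :=
  WithLp.toLp 2 (fun i => z (k.succAbove i) / z k)

variable (ε : ℝ) (k : Fin (n + 1))

theorem smul_insertCoord_affineMap {z : CVec (n + 1)} (hk : z k ≠ 0) :
    z k • insertCoord k 1 (affineMap k z) = z := by
  ext i
  induction i using Fin.succAboveCases k
  · simp [insertCoord]
  · simp [insertCoord, affineMap]
    field_simp

theorem contDiffAt_affineMap {z : CVec (n + 1)} (hk : z k ≠ 0) {N : ℕ∞ω} :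
    ContDiffAt ℝ N (affineMap k) z := by
  have hc : ∀ i, ContDiffAt ℝ N (fun z : CVec (n + 1) => z i) z := fun i =>
    ((EuclideanSpace.proj i : CVec (n + 1) →L[ℂ] ℂ).restrictScalars ℝ).contDiff.contDiffAt
  refine (contDiffAt_piLp 2).2 fun i => ?_
  have hinv : ContDiffAt ℝ N (fun z : CVec (n + 1) => (z k)⁻¹) z := (hc k).inv hk
  simpa [affineMap, div_eq_mul_inv] using (hc (k.succAbove i)).mul hinv

/-- The horizontal vector at `z` which projects to the tangent vector with affine coordinates `u`
at `[z]`. -/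
def horizontalLift (z : CVec (n + 1)) (u : CVec n) : CVec (n + 1) :=
  horizontal ε z (z k • insertZero k u)

theorem horizontalLift_smul (z : CVec (n + 1)) (c : ℂ) (u : CVec n) :
    horizontalLift ε k z (c • u) = c • horizontalLift ε k z u := by
  rw [horizontalLift, horizontalLift, insertZero_smul, smul_comm (z k) c, horizontal, horizontal,
    herm_smul_left, smul_sub, smul_smul c (_ / _), mul_div_assoc]

theorem horizontalLift_eq {z : CVec (n + 1)} (hk : z k ≠ 0) (u : CVec n) :
    horizontalLift ε k z u
      = z k • horizontal ε (insertCoord k 1 (affineMap k z)) (insertZero k u) := by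
  rw [← horizontal_smul_smul ε hk, smul_insertCoord_affineMap k hk, horizontalLift]

theorem horizontalLift_ne_zero {z : CVec (n + 1)} (hk : z k ≠ 0) {u : CVec n} (hu : u ≠ 0) :
    horizontalLift ε k z u ≠ 0 := by
  intro h
  rw [horizontalLift_eq ε k hk, smul_eq_zero, or_iff_right hk, horizontal, sub_eq_zero] at h
  generalize herm ε _ _ / herm ε _ _ = c at h
  have h1 : c = 0 := by
    have := congrArg (fun x : CVec (n + 1) => x k) h
    simpa [insertCoord, insertZero_apply] using this.symm
  refine hu (PiLp.ext fun i => ?_)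
  have h2 := congrArg (fun x : CVec (n + 1) => x (k.succAbove i)) h
  simpa [insertCoord, insertZero_apply, h1] using h2

variable {ε k}

theorem abs_sign (hε : ε = 1 ∨ ε = -1) : |ε| = 1 := by
  rcases hε with rfl | rfl <;> simp

theorem sign_ne_zero (hε : ε = 1 ∨ ε = -1) : ε ≠ 0 := by
  rcases hε with rfl | rfl <;> simp

theorem normSq_mul_herm_affine {z : CVec (n + 1)} (hz : herm ε z z = ε) (hk : z k ≠ 0) :
    Complex.normSq (z k) *
      (herm ε (insertCoord k 1 (affineMap k z)) (insertCoord k 1 (affineMap k z))).re = ε := by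
  have h : herm ε (z k • insertCoord k 1 (affineMap k z)) (z k • insertCoord k 1 (affineMap k z))
      = ε := by
    rw [smul_insertCoord_affineMap k hk, hz]
  rw [herm_smul_smul, Complex.mul_conj] at h
  have := congrArg Complex.re h
  rwa [Complex.re_ofReal_mul, Complex.ofReal_re] at this

theorem herm_affine_ne_zero (hε : ε = 1 ∨ ε = -1) {z : CVec (n + 1)} (hz : herm ε z z = ε)
    (hk : z k ≠ 0) :
    herm ε (insertCoord k 1 (affineMap k z)) (insertCoord k 1 (affineMap k z)) ≠ 0 := by
  intro h
  have := normSq_mul_herm_affine hz hk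
  rw [h, Complex.zero_re, mul_zero] at this
  exact sign_ne_zero hε this.symm

theorem inv_abs_herm_affine (hε : ε = 1 ∨ ε = -1) {z : CVec (n + 1)} (hz : herm ε z z = ε)
    (hk : z k ≠ 0) :
    |(herm ε (insertCoord k 1 (affineMap k z)) (insertCoord k 1 (affineMap k z))).re|⁻¹
      = Complex.normSq (z k) := by
  have h := congrArg abs (normSq_mul_herm_affine hz hk)
  rw [abs_mul, abs_of_nonneg (Complex.normSq_nonneg _), abs_sign hε] at h
  exact inv_eq_of_mul_eq_one_left h

theorem chartMetric_affineMap (hε : ε = 1 ∨ ε = -1) {z : CVec (n + 1)} (hz : herm ε z z = ε)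
    (hk : z k ≠ 0) (u v : CVec n) :
    chartMetric ε k (affineMap k z) u v
      = (herm ε (horizontalLift ε k z u) (horizontalLift ε k z v)).re := by
  rw [horizontalLift_eq ε k hk, horizontalLift_eq ε k hk, herm_smul_smul, Complex.mul_conj,
    Complex.re_ofReal_mul, chartMetric, div_eq_mul_inv, inv_abs_herm_affine hε hz hk, mul_comm]
  rfl

theorem herm_horizontalLift_base (hε : ε = 1 ∨ ε = -1) {z : CVec (n + 1)} (hz : herm ε z z = ε)
    (u : CVec n) : herm ε (horizontalLift ε k z u) z = 0 :=
  herm_horizontal_base ε (by rw [hz]; exact_mod_cast sign_ne_zero hε) _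

end HorizontalLift

section LocalLift

variable {n : ℕ} {ε : ℝ} {k : Fin (n + 1)} {E : Type*} [NormedAddCommGroup E] [NormedSpace ℝ E]
  {G : E → CVec (n + 1)} {p : E}

theorem differentiableAt_affineMap_comp (hG : DifferentiableAt ℝ G p) (hk : G p k ≠ 0) :
    DifferentiableAt ℝ (affineMap k ∘ G) p :=
  ((contDiffAt_affineMap k hk (N := 1)).differentiableAt one_ne_zero).comp p hG

/-- The `k`-th coordinate as a real linear map. -/
def coordCLM (k : Fin (n + 1)) : CVec (n + 1) →L[ℝ] ℂ :=
  (EuclideanSpace.proj k : CVec (n + 1) →L[ℂ] ℂ).restrictScalars ℝ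

theorem coordCLM_apply (z : CVec (n + 1)) : coordCLM k z = z k := rfl

theorem eventually_eq_smul_insertCoord {E : Type*} [TopologicalSpace E] {G : E → CVec (n + 1)}
    {p : E} (hG : ContinuousAt G p) (hk : G p k ≠ 0) :
    G =ᶠ[𝓝 p] fun y => coordCLM k (G y) • insertCoord k 1 ((affineMap k ∘ G) y) := by
  have : ContinuousAt (fun y => coordCLM k (G y)) p := (coordCLM k).continuous.continuousAt.comp hG
  filter_upwards [this.eventually_ne hk] with y hy
  exact (smul_insertCoord_affineMap k hy).symm

/-- The Leibniz rule for `G = G_k (1, f)`, where `f` denotes the affine coordinates of `[G]` and the `1`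
is in the `k`-th place. -/
theorem fderiv_eq_smul_add (hG : DifferentiableAt ℝ G p) (hk : G p k ≠ 0) (X : E) :
    fderiv ℝ G p X = G p k • insertZero k (fderiv ℝ (affineMap k ∘ G) p X)
      + fderiv ℝ G p X k • insertCoord k 1 (affineMap k (G p)) := by
  have h1 := (coordCLM k).hasFDerivAt.comp p hG.hasFDerivAt
  have h2 := (hasFDerivAt_insertCoord_one k _).comp p
    (differentiableAt_affineMap_comp hG hk).hasFDerivAt
  have h := congrArg (fun L : E →L[ℝ] CVec (n + 1) => L X)
    (((h1.smul h2).congr_of_eventuallyEq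
      (eventually_eq_smul_insertCoord hG.continuousAt hk)).fderiv)
  exact h

/-- Horizontality determines the vertical component of the derivative of the lift. -/
theorem fderiv_coord_eq (hε : ε = 1 ∨ ε = -1) (hG : DifferentiableAt ℝ G p)
    (hz : herm ε (G p) (G p) = ε) (hk : G p k ≠ 0) (X : E)
    (hhor : herm ε (fderiv ℝ G p X) (G p) = 0) :
    fderiv ℝ G p X k =
      -(G p k * (herm ε (insertZero k (fderiv ℝ (affineMap k ∘ G) p X))
          (insertCoord k 1 (affineMap k (G p)))
        / herm ε (insertCoord k 1 (affineMap k (G p))) (insertCoord k 1 (affineMap k (G p))))) := by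
  have hq := herm_affine_ne_zero hε hz hk
  have h : herm ε (fderiv ℝ G p X) (insertCoord k 1 (affineMap k (G p))) = 0 := by
    have h' : herm ε (fderiv ℝ G p X) (G p k • insertCoord k 1 (affineMap k (G p))) = 0 := by
      rw [smul_insertCoord_affineMap k hk, hhor]
    rwa [herm_smul_right, mul_eq_zero, or_iff_right (by simpa using hk)] at h'
  rw [fderiv_eq_smul_add hG hk X, herm_add_left, herm_smul_left, herm_smul_left] at h
  field_simp
  linear_combination h

theorem fderiv_eq_horizontalLift (hε : ε = 1 ∨ ε = -1) (hG : DifferentiableAt ℝ G p)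
    (hz : herm ε (G p) (G p) = ε) (hk : G p k ≠ 0) (X : E)
    (hhor : herm ε (fderiv ℝ G p X) (G p) = 0) :
    fderiv ℝ G p X = horizontalLift ε k (G p) (fderiv ℝ (affineMap k ∘ G) p X) := by
  rw [fderiv_eq_smul_add hG hk X, fderiv_coord_eq hε hG hz hk X hhor, horizontalLift_eq ε k hk,
    horizontal, smul_sub, smul_smul, neg_smul, ← sub_eq_add_neg]

/-- The second fundamental form of a map into the orbit space is the horizontal part of the second
derivative of a horizontal lift. -/
theorem secondFundamentalForm_eq (hε : ε = 1 ∨ ε = -1) (hG : ContDiffAt ℝ 2 G p)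
    (hz : herm ε (G p) (G p) = ε) (hk : G p k ≠ 0)
    (hhor : ∀ X, herm ε (fderiv ℝ G p X) (G p) = 0) (X Y : E) (ν : CVec n) :
    secondFundamentalForm (chartMetric ε k) (affineMap k ∘ G) p X Y ν
      = (herm ε (fderiv ℝ (fderiv ℝ G) p X Y) (horizontalLift ε k (G p) ν)).re := by
  have h2 : (2 : ℕ∞ω) ≠ 0 := by norm_num
  have hGd := hG.differentiableAt h2
  have hf : ContDiffAt ℝ 2 (affineMap k ∘ G) p := (contDiffAt_affineMap k hk).comp p hG
  have hq := herm_affine_ne_zero hε hz hk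
  have hZ : ContDiffAt ℝ 2 (fun y => insertCoord k 1 ((affineMap k ∘ G) y)) p := by
    simp_rw [insertCoord_one k ((affineMap k ∘ G) _)]
    exact contDiffAt_const.add ((insertZero k).contDiff.contDiffAt.comp p hf)
  have hc : ContDiffAt ℝ 2 (fun y => coordCLM k (G y)) p :=
    (coordCLM k).contDiff.contDiffAt.comp p hG
  have dZ : ∀ W, (fun y => fderiv ℝ (fun y => insertCoord k 1 ((affineMap k ∘ G) y)) y W)
      =ᶠ[𝓝 p] fun y => insertZero k (fderiv ℝ (affineMap k ∘ G) y W) := by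
    intro W
    filter_upwards [eventually_differentiableAt hf] with y hy
    have := ((hasFDerivAt_insertCoord_one k _).comp y hy.hasFDerivAt).fderiv
    exact congrArg (fun L : E →L[ℝ] CVec (n + 1) => L W) this
  have d2Z : fderiv ℝ (fderiv ℝ (fun y => insertCoord k 1 ((affineMap k ∘ G) y))) p X Y
      = insertZero k (fderiv ℝ (fderiv ℝ (affineMap k ∘ G)) p X Y) := by
    rw [fderiv_fderiv_apply hZ, (dZ Y).fderiv_eq, fderiv_fderiv_apply hf]
    have := ((insertZero k).hasFDerivAt.comp p
      (differentiableAt_fderiv_apply hf Y).hasFDerivAt).fderiv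
    exact congrArg (fun L : E →L[ℝ] CVec (n + 1) => L X) this
  have dc : ∀ W, fderiv ℝ (fun y => coordCLM k (G y)) p W = fderiv ℝ G p W k := fun W =>
    congrArg (fun L : E →L[ℝ] ℂ => L W) ((coordCLM k).hasFDerivAt.comp p hGd.hasFDerivAt).fderiv
  -- The Leibniz rule for `G = G_k (1, f)`; the term `D²G_k (1, f)` is vertical, and the two cross terms
  -- are the Christoffel symbols, because horizontality determines `DG_k`.
  have hG2 : fderiv ℝ (fderiv ℝ G) p X Y = _ :=
    (congrArg (fun L : E →L[ℝ] E →L[ℝ] CVec (n + 1) => L X Y)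
      (eventually_eq_smul_insertCoord hG.continuousAt hk).fderiv.fderiv_eq).trans
    (fderiv_fderiv_bilinear (ContinuousLinearMap.lsmul ℝ ℂ) hc hZ X Y)
  have hZn : herm ε (insertCoord k 1 (affineMap k (G p)))
      (horizontal ε (insertCoord k 1 (affineMap k (G p))) (insertZero k ν)) = 0 := by
    rw [← conj_herm, herm_horizontal_base ε hq, map_zero]
  rw [hG2, d2Z, dc, dc, (dZ X).eq_of_nhds, (dZ Y).eq_of_nhds,
    fderiv_coord_eq hε hGd hz hk X (hhor X), fderiv_coord_eq hε hGd hz hk Y (hhor Y),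
    secondFundamentalForm, horizontalLift_eq ε k hk]
  have e := christoffel_chartMetric ε k hq (fderiv ℝ (affineMap k ∘ G) p X)
    (fderiv ℝ (affineMap k ∘ G) p Y) ν
  have e' := chartMetric_eq ε k hq (fderiv ℝ (fderiv ℝ (affineMap k ∘ G)) p X Y) ν
  rw [div_eq_mul_inv, inv_abs_herm_affine hε hz hk] at e e'
  simp only [Function.comp_apply] at e e' ⊢
  rw [e, e']
  simp only [ContinuousLinearMap.lsmul_apply, coordCLM_apply, herm_add_left, herm_smul_left,
    herm_smul_right, hZn]
  rw [← add_mul, ← Complex.neg_re, ← Complex.add_re, ← Complex.re_mul_ofReal, ← Complex.mul_conj]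
  congr 1
  ring

end LocalLift

/-! ### Orthonormal frames and minimal second-order jets -/

section Frames

variable {E : Type*} [AddCommGroup E] [Module ℝ E] [FiniteDimensional ℝ E]

theorem eq_sum_of_orthonormal (b : LinearMap.BilinForm ℝ E) {e : Fin (Module.finrank ℝ E) → E}
    (he : ∀ i j, b (e i) (e j) = if i = j then 1 else 0) (X : E) : X = ∑ i, b X (e i) • e i := by
  have hli : LinearIndependent ℝ e := by
    rw [Fintype.linearIndependent_iff]
    intro g hg j
    have := congrArg (fun x => b x (e j)) hg
    simpa [he] using this
  let B := basisOfLinearIndependentOfCardEqFinrank' e hli (by simp)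
  have hB : ⇑B = e := coe_basisOfLinearIndependentOfCardEqFinrank' e hli (by simp)
  conv_lhs => rw [← B.sum_repr X]
  refine Finset.sum_congr rfl fun i _ => ?_
  have : b X (e i) = B.repr X i := by
    conv_lhs => rw [← B.sum_repr X]
    simp [hB, he]
  rw [this, hB]

theorem exists_orthonormal (b : LinearMap.BilinForm ℝ E) (hb : ∀ X Y, b X Y = b Y X)
    (hpos : ∀ X, X ≠ 0 → 0 < b X X) :
    ∃ e : Fin (Module.finrank ℝ E) → E, ∀ i j, b (e i) (e j) = if i = j then 1 else 0 := by
  obtain ⟨v, hv⟩ := LinearMap.BilinForm.exists_orthogonal_basis (B := b) ⟨fun X Y => hb X Y⟩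
  refine ⟨fun i => (√(b (v i) (v i)))⁻¹ • v i, fun i j => ?_⟩
  have hi := hpos _ (v.ne_zero i)
  simp only [map_smul, LinearMap.smul_apply, smul_eq_mul]
  split_ifs with h
  · subst h
    rw [← mul_assoc, ← mul_inv, Real.mul_self_sqrt hi.le, inv_mul_cancel₀ hi.ne']
  · rw [show b (v i) (v j) = 0 from hv h]
    simp

/-- The trace of a bilinear form with respect to a scalar product may be computed in any orthonormal
frame. -/
theorem sum_orthonormal_eq (b B : LinearMap.BilinForm ℝ E) (hb : ∀ X Y, b X Y = b Y X)
    {e e' : Fin (Module.finrank ℝ E) → E} (he : ∀ i j, b (e i) (e j) = if i = j then 1 else 0)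
    (he' : ∀ i j, b (e' i) (e' j) = if i = j then 1 else 0) :
    ∑ i, B (e i) (e i) = ∑ i, B (e' i) (e' i) := by
  have h1 : ∀ j, B (e' j) (e' j) = ∑ i, ∑ l, b (e' j) (e i) * b (e' j) (e l) * B (e i) (e l) := by
    intro j
    conv_lhs => rw [eq_sum_of_orthonormal b he (e' j)]
    simp only [map_sum, LinearMap.sum_apply, map_smul, LinearMap.smul_apply, smul_eq_mul,
      Finset.mul_sum]
    rw [Finset.sum_comm]
    exact Finset.sum_congr rfl fun i _ => Finset.sum_congr rfl fun l _ => by ring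
  have h2 : ∀ i l, ∑ j, b (e' j) (e i) * b (e' j) (e l) = if i = l then 1 else 0 := by
    intro i l
    rw [← he i l]
    conv_rhs => rw [eq_sum_of_orthonormal b he' (e i)]
    simp only [map_sum, LinearMap.sum_apply, map_smul, LinearMap.smul_apply, smul_eq_mul]
    exact Finset.sum_congr rfl fun j _ => by rw [hb (e i)]
  rw [Finset.sum_congr rfl fun j _ => h1 j, Finset.sum_comm]
  refine Finset.sum_congr rfl fun i _ => ?_
  rw [Finset.sum_comm]
  simp [← Finset.sum_mul, h2]

end Frames

section Jets

variable {V E : Type*} [NormedAddCommGroup V] [NormedSpace ℝ V] [NormedAddCommGroup E]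
  [NormedSpace ℝ E]

/-- The condition on the first and second derivatives `L`, `S` of a map into a space with a Hermitian
form `h` (a horizontal lift, or a map into `ℂⁿ`) which expresses that the map is Lagrangian and
minimal: there is a frame on which `h` restricts to the identity matrix, and the trace of `S` in this
frame is orthogonal to `J L Y` for all `Y`. -/
def IsMinimalJet (h : V →L[ℝ] V →L[ℝ] ℂ) (L : E →L[ℝ] V) (S : E →L[ℝ] E →L[ℝ] V) : Prop :=
  ∃ e : Fin (Module.finrank ℝ E) → E, (∀ i j, h (L (e i)) (L (e j)) = if i = j then 1 else 0) ∧
    ∀ Y, (∑ i, h (S (e i) (e i)) (L Y)).im = 0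

/-- The real bilinear form `Re h(L X, L Y)`. -/
def pullbackMetric (h : V →L[ℝ] V →L[ℝ] ℂ) (L : E →L[ℝ] V) : LinearMap.BilinForm ℝ E :=
  LinearMap.mk₂ ℝ (fun X Y => (h (L X) (L Y)).re) (by simp) (by simp) (by simp) (by simp)

theorem pullbackMetric_apply (h : V →L[ℝ] V →L[ℝ] ℂ) (L : E →L[ℝ] V) (X Y : E) :
    pullbackMetric h L X Y = (h (L X) (L Y)).re := rfl

theorem isMinimalJet_of_forall [FiniteDimensional ℝ E] {h : V →L[ℝ] V →L[ℝ] ℂ} {L : E →L[ℝ] V}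
    {S : E →L[ℝ] E →L[ℝ] V} (hconj : ∀ u v, conj (h u v) = h v u)
    (hlag : ∀ X Y, (h (L X) (L Y)).im = 0) (hpos : ∀ X, X ≠ 0 → 0 < (h (L X) (L X)).re)
    (hmin : ∀ e : Fin (Module.finrank ℝ E) → E,
      (∀ i j, (h (L (e i)) (L (e j))).re = if i = j then 1 else 0) →
      ∀ Y, (∑ i, h (S (e i) (e i)) (L Y)).im = 0) :
    IsMinimalJet h L S := by
  obtain ⟨e, he⟩ := exists_orthonormal (pullbackMetric h L)
    (fun X Y => by rw [pullbackMetric_apply, pullbackMetric_apply, ← hconj, Complex.conj_re]) hpos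
  refine ⟨e, fun i j => Complex.ext ?_ ?_, hmin e he⟩
  · rw [← pullbackMetric_apply, he]
    split_ifs <;> simp
  · rw [hlag]
    split_ifs <;> simp

section Frame

variable {h : V →L[ℝ] V →L[ℝ] ℂ} {L : E →L[ℝ] V} {e : Fin (Module.finrank ℝ E) → E}

theorem pullbackMetric_frame
    (he : ∀ i j, h (L (e i)) (L (e j)) = if i = j then 1 else 0)
    (i j : Fin (Module.finrank ℝ E)) :
    pullbackMetric h L (e i) (e j) = if i = j then 1 else 0 := by
  rw [pullbackMetric_apply, he]
  split_ifs <;> simp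

variable [FiniteDimensional ℝ E]

theorem eq_sum_of_frame
    (he : ∀ i j, h (L (e i)) (L (e j)) = if i = j then 1 else 0)
    (X : E) : X = ∑ i, pullbackMetric h L X (e i) • e i :=
  eq_sum_of_orthonormal _ (pullbackMetric_frame he) X

theorem form_im_eq_zero_of_frame
    (he : ∀ i j, h (L (e i)) (L (e j)) = if i = j then 1 else 0)
    (X Y : E) : (h (L X) (L Y)).im = 0 := by
  rw [eq_sum_of_frame he X, eq_sum_of_frame he Y]
  simp [he]

end Frame

end Jets

section OrbitSpace

variable {n : ℕ} {ε : ℝ} {k : Fin (n + 1)} {E : Type*} [NormedAddCommGroup E] [NormedSpace ℝ E]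
  {G : E → CVec (n + 1)} {p : E}

theorem chartMetric_fderiv (hε : ε = 1 ∨ ε = -1) (hG : DifferentiableAt ℝ G p)
    (hz : herm ε (G p) (G p) = ε) (hk : G p k ≠ 0)
    (hhor : ∀ X, herm ε (fderiv ℝ G p X) (G p) = 0) (X : E) (ν : CVec n) :
    chartMetric ε k ((affineMap k ∘ G) p) (fderiv ℝ (affineMap k ∘ G) p X) ν
      = (herm ε (fderiv ℝ G p X) (horizontalLift ε k (G p) ν)).re := by
  rw [Function.comp_apply, chartMetric_affineMap hε hz hk,
    ← fderiv_eq_horizontalLift hε hG hz hk X (hhor X)]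

variable [FiniteDimensional ℝ E]

/-- A minimal Lagrangian immersion, written in an affine chart, in terms of a horizontal lift `G`. -/
theorem isMinimalJet_of_chart (hε : ε = 1 ∨ ε = -1) (hG : ContDiffAt ℝ 2 G p)
    (hz : herm ε (G p) (G p) = ε) (hk : G p k ≠ 0)
    (hhor : ∀ X, herm ε (fderiv ℝ G p X) (G p) = 0)
    (himm : Function.Injective (fderiv ℝ (affineMap k ∘ G) p))
    (hlag : ∀ X Y : E, chartMetric ε k ((affineMap k ∘ G) p)
      (Complex.I • fderiv ℝ (affineMap k ∘ G) p X) (fderiv ℝ (affineMap k ∘ G) p Y) = 0)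
    (hmin : MeanCurvatureVanishesAt (chartMetric ε k) (affineMap k ∘ G) p) :
    IsMinimalJet (hermCLM ε n) (fderiv ℝ G p) (fderiv ℝ (fderiv ℝ G) p) := by
  have hGd := hG.differentiableAt (by norm_num)
  have hL : ∀ X, fderiv ℝ G p X = _ := fun X => fderiv_eq_horizontalLift hε hGd hz hk X (hhor X)
  have hlag' : ∀ X Y, (herm ε (fderiv ℝ G p X) (fderiv ℝ G p Y)).im = 0 := by
    intro X Y
    have := hlag X Y
    rw [Function.comp_apply, chartMetric_affineMap hε hz hk, horizontalLift_smul, ← hL, ← hL,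
      herm_smul_left, Complex.I_mul_re] at this
    linarith
  refine isMinimalJet_of_forall (conj_herm ε) hlag' (fun X hX => ?_) fun e he Y => ?_
  · refine herm_self_pos ε hε hz (hhor X) ?_
    rw [hL]
    exact horizontalLift_ne_zero ε k hk ((map_ne_zero_iff _ himm).2 hX)
  -- The vector `J f_* Y` is normal to the Lagrangian immersion `f`.
  · have := hmin e (fun i j => ?_) (Complex.I • fderiv ℝ (affineMap k ∘ G) p Y) fun X => ?_
    · rw [Finset.sum_congr rfl fun i _ => secondFundamentalForm_eq hε hG hz hk hhor _ _ _] at this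
      simp only [horizontalLift_smul, ← hL, herm_smul_right] at this
      simpa using this
    · rw [chartMetric_fderiv hε hGd hz hk hhor, ← hL]
      exact he i j
    · rw [chartMetric_fderiv hε hGd hz hk hhor, horizontalLift_smul, ← hL, herm_smul_right]
      simp [hlag']

/-- A vector orthogonal to a horizontal lift and real-orthogonal to its derivatives is `J` times a
tangent vector: the lift and an orthonormal frame together are a basis of `ℂⁿ⁺¹`. -/
theorem exists_eq_sum_of_normal {ι : Type*} [Fintype ι] [DecidableEq ι] (hε : ε = 1 ∨ ε = -1)
    {z : CVec (n + 1)} {e : ι → CVec (n + 1)} (hz : herm ε z z = ε) (hez : ∀ i, herm ε (e i) z = 0)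
    (he : ∀ i j, herm ε (e i) (e j) = if i = j then 1 else 0) (hcard : Fintype.card ι = n)
    {ν : CVec (n + 1)} (hνz : herm ε ν z = 0) (hν : ∀ i, (herm ε (e i) ν).re = 0) :
    ∃ t : ι → ℝ, ν = ∑ i, ((t i : ℂ) * Complex.I) • e i := by
  have hε0 : (ε : ℂ) ≠ 0 := by exact_mod_cast sign_ne_zero hε
  let v : Option ι → CVec (n + 1) := fun o => o.elim z e
  have hze : ∀ i, herm ε z (e i) = 0 := fun i => by rw [← conj_herm, hez, map_zero]
  have hli : LinearIndependent ℂ v := by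
    rw [Fintype.linearIndependent_iff]
    intro g hg o
    have h := congrArg (fun x => herm ε x (v o)) hg
    simp only [Fintype.sum_option, herm_add_left, herm_sum_left, herm_smul_left,
      herm_zero_left] at h
    cases o with
    | none => simpa [v, hez, hz, hε0] using h
    | some i => simpa [v, hze, he] using h
  have htop := hli.span_eq_top_of_card_eq_finrank' (by simp [hcard])
  have hmem : ν ∈ Submodule.span ℂ (Set.range v) := htop ▸ Submodule.mem_top
  obtain ⟨c, hc⟩ := (Submodule.mem_span_range_iff_exists_fun ℂ).1 hmem
  rw [Fintype.sum_option] at hc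
  have h0 : c none = 0 := by
    have h := congrArg (fun x => herm ε x z) hc
    simpa [herm_add_left, herm_sum_left, herm_smul_left, v, hez, hz, hε0, hνz] using h
  have h1 : ∀ i, c (some i) = herm ε ν (e i) := fun i => by
    have h := congrArg (fun x => herm ε x (e i)) hc
    simpa [herm_add_left, herm_sum_left, herm_smul_left, v, he, hze] using h
  refine ⟨fun i => (herm ε ν (e i)).im, ?_⟩
  conv_lhs => rw [← hc, h0, zero_smul, zero_add]
  refine Finset.sum_congr rfl fun i _ => ?_
  have hre : (herm ε ν (e i)).re = 0 := by rw [← conj_herm, Complex.conj_re, hν]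
  congr 1
  rw [h1]
  exact Complex.ext (by simp [hre]) (by simp)

/-- The converse of `isMinimalJet_of_chart`, for a Lagrangian dimension of the domain. -/
theorem chart_of_isMinimalJet (hε : ε = 1 ∨ ε = -1) (hG : ContDiffAt ℝ 2 G p)
    (hz : herm ε (G p) (G p) = ε) (hk : G p k ≠ 0)
    (hhor : ∀ X, herm ε (fderiv ℝ G p X) (G p) = 0) (hdim : Module.finrank ℝ E = n)
    (hjet : IsMinimalJet (hermCLM ε n) (fderiv ℝ G p) (fderiv ℝ (fderiv ℝ G) p)) :
    Function.Injective (fderiv ℝ (affineMap k ∘ G) p) ∧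
    (∀ X Y : E, chartMetric ε k ((affineMap k ∘ G) p)
      (Complex.I • fderiv ℝ (affineMap k ∘ G) p X) (fderiv ℝ (affineMap k ∘ G) p Y) = 0) ∧
    MeanCurvatureVanishesAt (chartMetric ε k) (affineMap k ∘ G) p := by
  obtain ⟨e, he, htr⟩ := hjet
  have hGd := hG.differentiableAt (by norm_num)
  have hL : ∀ X, fderiv ℝ G p X = _ := fun X => fderiv_eq_horizontalLift hε hGd hz hk X (hhor X)
  refine ⟨(injective_iff_map_eq_zero _).2 fun X hX => ?_, fun X Y => ?_, fun e' he' ν hν => ?_⟩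
  · have h0 : fderiv ℝ G p X = 0 := by
      rw [hL, hX]
      simpa using horizontalLift_smul ε k (G p) 0 0
    rw [eq_sum_of_frame he X]
    simp [pullbackMetric_apply, h0]
  · rw [Function.comp_apply, chartMetric_affineMap hε hz hk, horizontalLift_smul, ← hL, ← hL,
      herm_smul_left, Complex.I_mul_re, neg_eq_zero]
    exact form_im_eq_zero_of_frame he X Y
  · simp only [chartMetric_fderiv hε hGd hz hk hhor] at he' hν
    rw [Finset.sum_congr rfl fun i _ => secondFundamentalForm_eq hε hG hz hk hhor _ _ _]
    obtain ⟨t, ht⟩ := exists_eq_sum_of_normal hε hz (fun i => hhor (e i)) he (by simp [hdim])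
      (herm_horizontalLift_base hε hz ν) (fun i => hν (e i))
    generalize horizontalLift ε k (G p) ν = ν' at ht
    -- The trace in the given frame `e'` is computed in the frame `e`, and the normal vector is a
    -- combination of the vectors `J DG(e j)`.
    let B : LinearMap.BilinForm ℝ E := LinearMap.mk₂ ℝ
      (fun X Y => (hermCLM ε n (fderiv ℝ (fderiv ℝ G) p X Y) ν').re)
      (by simp) (by simp) (by simp) (by simp)
    have htrace := sum_orthonormal_eq (pullbackMetric (hermCLM ε n) (fderiv ℝ G p)) B
      (fun X Y => by
        rw [pullbackMetric_apply, pullbackMetric_apply, hermCLM_apply, hermCLM_apply, ← conj_herm,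
          Complex.conj_re])
      (e := e) (e' := e') (pullbackMetric_frame he)
      (fun i j => by
        rw [pullbackMetric_apply, ← he', hL (e' j)]
        rfl)
    refine htrace.symm.trans ?_
    change ∑ i, (hermCLM ε n (fderiv ℝ (fderiv ℝ G) p (e i) (e i)) ν').re = 0
    rw [← Complex.re_sum, ht]
    have : ∀ w, hermCLM ε n w (∑ j, ((t j : ℂ) * Complex.I) • fderiv ℝ G p (e j))
        = ∑ j, -((t j : ℂ) * Complex.I) * hermCLM ε n w (fderiv ℝ G p (e j)) := by
      intro w
      rw [map_sum]
      refine Finset.sum_congr rfl fun j _ => ?_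
      rw [hermCLM_apply, herm_smul_right]
      simp
    rw [Finset.sum_congr rfl fun i _ => this _, Finset.sum_comm, Complex.re_sum]
    refine Finset.sum_eq_zero fun j _ => ?_
    rw [← Finset.mul_sum, neg_mul, Complex.neg_re, mul_assoc, Complex.re_ofReal_mul,
      Complex.I_mul_re, htr (e j)]
    simp

end OrbitSpace

/-! ### Passing between a manifold and its charts -/

section Manifold

variable {E H M : Type*} [NormedAddCommGroup E] [NormedSpace ℝ E] [TopologicalSpace H]
  [TopologicalSpace M] [ChartedSpace H M] {I : ModelWithCorners ℝ E H} [I.Boundaryless]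

theorem contMDiffAt_iff_chart {V : Type*} [NormedAddCommGroup V] [NormedSpace ℝ V] {N : ℕ∞ω}
    {f : M → V} {x : M} :
    ContMDiffAt I 𝓘(ℝ, V) N f x ↔
      ContinuousAt f x ∧ ContDiffAt ℝ N (f ∘ (extChartAt I x).symm) (extChartAt I x x) := by
  rw [contMDiffAt_iff, I.range_eq_univ, contDiffWithinAt_univ]
  rfl

theorem chart_fderiv [IsManifold I ∞ M] {V : Type*} [NormedAddCommGroup V] [NormedSpace ℝ V]
    {f : M → V} {x : M} {y : E} (hy : y ∈ (extChartAt I x).target)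
    (hf : MDifferentiableAt I 𝓘(ℝ, V) f ((extChartAt I x).symm y)) :
    DifferentiableAt ℝ (f ∘ (extChartAt I x).symm) y ∧ ∀ X,
      fderiv ℝ (f ∘ (extChartAt I x).symm) y X = mfderiv I 𝓘(ℝ, V) f ((extChartAt I x).symm y)
        (mfderiv 𝓘(ℝ, E) I (extChartAt I x).symm y X) := by
  have : IsManifold I 1 M := IsManifold.of_le (n := ∞) (by simp)
  have hs : MDifferentiableAt 𝓘(ℝ, E) I (extChartAt I x).symm y := by
    have := mdifferentiableWithinAt_extChartAt_symm hy
    rwa [I.range_eq_univ, mdifferentiableWithinAt_univ] at this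
  refine ⟨(hf.comp y hs).differentiableAt, fun X => ?_⟩
  rw [← mfderiv_eq_fderiv, mfderiv_comp y hf hs]
  rfl

theorem eventually_mem_target (x : M) :
    ∀ᶠ y in 𝓝 (extChartAt I x x), y ∈ (extChartAt I x).target :=
  extChartAt_target_mem_nhds x

variable {n : ℕ} {ε : ℝ}

theorem mem_affineDomain_iff {k : Fin (n + 1)} (z : Quadric ε n) :
    hopf z ∈ affineDomain k ↔ z.1 k ≠ 0 := by
  refine ⟨?_, fun h => ⟨z, rfl, h⟩⟩
  rintro ⟨w, hw, hwk⟩ hz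
  obtain ⟨c, hc, h⟩ := Quotient.exact hw
  rw [h] at hz
  have hc0 : c ≠ 0 := by
    rintro rfl
    simp at hc
  simp [hc0, hwk] at hz

theorem exists_coord_ne_zero (hε : ε = 1 ∨ ε = -1) (z : Quadric ε n) : ∃ k, z.1 k ≠ 0 := by
  by_contra! h
  have h0 : z.1 = 0 := PiLp.ext h
  have := z.2
  rw [h0, herm_zero_left] at this
  exact sign_ne_zero hε (by exact_mod_cast this.symm)

variable [FiniteDimensional ℝ E]

/-- A minimal Lagrangian immersion in the orbit space, in terms of a horizontal lift written in a
chart of its domain. -/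
theorem isMinimalJet_of_isMinimalLagrangian (hε : ε = 1 ∨ ε = -1) {φ : M → HopfBase ε n}
    (hφ : IsMinimalLagrangian I φ) {φl : M → Quadric ε n}
    (hl : IsHorizontalLift I φl φ) (x : M)
    (hhor : ∀ X, herm ε (fderiv ℝ ((fun y => (φl y).1) ∘ (extChartAt I x).symm) (extChartAt I x x) X)
      (φl x).1 = 0) :
    IsMinimalJet (hermCLM ε n)
      (fderiv ℝ ((fun y => (φl y).1) ∘ (extChartAt I x).symm) (extChartAt I x x))
      (fderiv ℝ (fderiv ℝ ((fun y => (φl y).1) ∘ (extChartAt I x).symm)) (extChartAt I x x)) := by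
  have hinv : (extChartAt I x).symm (extChartAt I x x) = x := extChartAt_to_inv x
  obtain rfl : (fun x => hopf (φl x)) = φ := funext hl.lift
  obtain ⟨k, hk⟩ := exists_coord_ne_zero hε (φl x)
  obtain ⟨-, hmin⟩ := hφ x k ((mem_affineDomain_iff _).2 hk)
  have hG := (contMDiffAt_iff_chart.1 (hl.smooth x)).2
  have hval : ((fun y => (φl y).1) ∘ (extChartAt I x).symm) (extChartAt I x x) = (φl x).1 := by
    rw [Function.comp_apply, hinv]
  have hG2 : ContDiffAt ℝ 2 _ _ := hG.of_le (WithTop.coe_le_coe.2 le_top)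
  exact isMinimalJet_of_chart hε hG2 (by rw [hval]; exact (φl x).2)
    (by rwa [hval]) (by rwa [hval]) hmin.immersion
    (by rw [Function.comp_apply, hval]; exact hmin.lagrangian) hmin.minimal

/-- The converse of `isMinimalJet_of_isMinimalLagrangian`. -/
theorem isMinimalLagrangian_of_isMinimalJet (hε : ε = 1 ∨ ε = -1) {Gl : M → Quadric ε n}
    (hG : ContMDiff I 𝓘(ℝ, CVec (n + 1)) ∞ fun x => (Gl x).1) (hdim : Module.finrank ℝ E = n)
    (hhor : ∀ x X, herm ε
      (fderiv ℝ ((fun y => (Gl y).1) ∘ (extChartAt I x).symm) (extChartAt I x x) X) (Gl x).1 = 0)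
    (hjet : ∀ x, IsMinimalJet (hermCLM ε n)
      (fderiv ℝ ((fun y => (Gl y).1) ∘ (extChartAt I x).symm) (extChartAt I x x))
      (fderiv ℝ (fderiv ℝ ((fun y => (Gl y).1) ∘ (extChartAt I x).symm)) (extChartAt I x x))) :
    IsMinimalLagrangian I fun x => hopf (Gl x) := by
  intro x k hk
  rw [mem_affineDomain_iff] at hk
  have hinv : (extChartAt I x).symm (extChartAt I x x) = x := extChartAt_to_inv x
  have hval : ((fun y => (Gl y).1) ∘ (extChartAt I x).symm) (extChartAt I x x) = (Gl x).1 := by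
    rw [Function.comp_apply, hinv]
  have hGx := (contMDiffAt_iff_chart.1 (hG x)).2
  have hG2 : ContDiffAt ℝ 2 _ _ := hGx.of_le (WithTop.coe_le_coe.2 le_top)
  obtain ⟨h1, h2, h3⟩ := chart_of_isMinimalJet (k := k) hε hG2
    (by rw [hval]; exact (Gl x).2) (by rwa [hval]) (by rw [hval]; exact hhor x) hdim (hjet x)
  refine ⟨?_, hdim, ?_, h1, ?_, h3⟩
  · have hc : ContinuousAt (fun y => coordCLM k (Gl y).1) x :=
      (coordCLM k).continuous.continuousAt.comp (hG x).continuousAt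
    filter_upwards [hc.eventually_ne hk] with y hy
    exact (mem_affineDomain_iff _).2 hy
  · exact ContMDiffAt.comp (g := affineMap k) (f := fun x => (Gl x).1) x
      (contDiffAt_affineMap k hk).contMDiffAt (hG x)
  · rw [Function.comp_apply, hval] at h2
    exact h2

end Manifold

/-! ### Second-order jets on `ℝ × N` -/

section Product

variable {V W E : Type*} [NormedAddCommGroup V] [NormedSpace ℝ V] [NormedAddCommGroup W]
  [NormedSpace ℝ W] [NormedAddCommGroup E] [NormedSpace ℝ E]

theorem isMinimalJet_of_frame {ι : Type*} [Fintype ι] [DecidableEq ι]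
    {h : V →L[ℝ] V →L[ℝ] ℂ} {L : E →L[ℝ] V} {S : E →L[ℝ] E →L[ℝ] V}
    (hcard : Fintype.card ι = Module.finrank ℝ E) (e : ι → E)
    (he : ∀ i j, h (L (e i)) (L (e j)) = if i = j then 1 else 0)
    (hS : ∀ Y, (∑ i, h (S (e i) (e i)) (L Y)).im = 0) : IsMinimalJet h L S := by
  let q := Fintype.equivFinOfCardEq hcard
  refine ⟨e ∘ q.symm, fun i j => by simp [he], fun Y => ?_⟩
  rw [← hS Y, ← q.symm.sum_comp]
  rfl

/-- A warped product criterion. The map `G` on `ℝ × E` has unit speed in the direction of `ℝ`, which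
is orthogonal to `E`, and restricts to `E` as the homothety of ratio `c` of a minimal Lagrangian map
with jet `(L₀, S₀)`. If the slices `E` have mean curvature `κ / c²` in the direction `J ∂ₛ`, then the
curvature of the curves `ℝ` in this direction has to be `-m κ / c²`. -/
theorem isMinimalJet_prod [FiniteDimensional ℝ E] {h : V →L[ℝ] V →L[ℝ] ℂ}
    {h₀ : W →L[ℝ] W →L[ℝ] ℂ} (hconj : ∀ u v, conj (h u v) = h v u) {L₀ : E →L[ℝ] W}
    {S₀ : E →L[ℝ] E →L[ℝ] W} {L : ℝ × E →L[ℝ] V} {S : ℝ × E →L[ℝ] ℝ × E →L[ℝ] V}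
    (hjet : IsMinimalJet h₀ L₀ S₀) {c κ : ℝ} (hc : c ≠ 0)
    (hss : h (L (1, 0)) (L (1, 0)) = 1) (hsv : ∀ v, h (L (1, 0)) (L (0, v)) = 0)
    (hvw : ∀ v w, h (L (0, v)) (L (0, w)) = c ^ 2 * h₀ (L₀ v) (L₀ w))
    (hssv : ∀ v, (h (S (1, 0) (1, 0)) (L (0, v))).im = 0)
    (hvvw : ∀ v w, (h (S (0, v) (0, v)) (L (0, w))).im = c ^ 2 * (h₀ (S₀ v v) (L₀ w)).im)
    (hvvs : ∀ v, (h (S (0, v) (0, v)) (L (1, 0))).im = κ * (h₀ (L₀ v) (L₀ v)).re)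
    (hsss : (h (S (1, 0) (1, 0)) (L (1, 0))).im + Module.finrank ℝ E * κ / c ^ 2 = 0) :
    IsMinimalJet h L S := by
  obtain ⟨e, he, htr⟩ := hjet
  have hsm : ∀ (a : ℝ) (v : E), ((0 : ℝ), a • v) = a • ((0 : ℝ), v) := by simp
  refine isMinimalJet_of_frame (ι := Option (Fin (Module.finrank ℝ E))) (by simp; ring)
    (fun o => o.elim (1, 0) fun i => (0, c⁻¹ • e i)) ?_ ?_
  · rintro (_ | i) (_ | j)
    · simpa using hss
    · simpa using hsv _
    · have := congrArg conj (hsv (c⁻¹ • e i))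
      rw [hconj] at this
      simpa using this
    · simp only [Option.elim_some, hvw, Option.some.injEq]
      have hc' : (c : ℂ) ≠ 0 := by exact_mod_cast hc
      simp only [map_smul, smul_apply, he, Complex.real_smul]
      push_cast
      split_ifs
      · field_simp
      · simp
  · rintro ⟨s, w⟩
    have hY : ((s, w) : ℝ × E) = s • ((1 : ℝ), (0 : E)) + ((0 : ℝ), w) := by simp
    rw [Fintype.sum_option, hY, Complex.add_im, Complex.im_sum]
    simp only [Option.elim_some, Option.elim_none, hsm, map_smul, map_add,
      smul_apply, Complex.add_im, Complex.smul_im, hssv, hvvw, hvvs, he,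
      smul_eq_mul, Finset.sum_add_distrib, ← Finset.mul_sum]
    have := htr w
    rw [Complex.im_sum] at this
    rw [this]
    simp
    field_simp at hsss
    field_simp
    linear_combination s * hsss

end Product

/-! ### Partial derivatives on `ℝ × E` -/

section Partial

variable {V W E : Type*} [NormedAddCommGroup V] [NormedSpace ℝ V] [NormedAddCommGroup W]
  [NormedSpace ℝ W] [NormedAddCommGroup E] [NormedSpace ℝ E]

theorem fderiv_comp_affine {f : W → V} {a : E → W} {A : E →L[ℝ] W}
    (ha : ∀ y, HasFDerivAt a A y) {p : E} (hf : ContDiffAt ℝ 2 f (a p)) (X Y : E) :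
    fderiv ℝ (fun y => f (a y)) p X = fderiv ℝ f (a p) (A X) ∧
    fderiv ℝ (fderiv ℝ (fun y => f (a y))) p X Y
      = fderiv ℝ (fderiv ℝ f) (a p) (A X) (A Y) := by
  have h1 : ∀ {y}, DifferentiableAt ℝ f (a y) → ∀ Z,
      fderiv ℝ (fun y => f (a y)) y Z = fderiv ℝ f (a y) (A Z) := fun {y} h Z =>
    congrArg (fun L : E →L[ℝ] V => L Z) (h.hasFDerivAt.comp y (ha y)).fderiv
  refine ⟨h1 (hf.differentiableAt (by norm_num)) X, ?_⟩
  have hac : ContDiff ℝ 2 a := by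
    refine contDiff_succ_iff_hasFDerivAt (n := 1) |>.2 ⟨fun _ => A, contDiff_const, ha⟩
  have hfa : ContDiffAt ℝ 2 (fun y => f (a y)) p := hf.comp p hac.contDiffAt
  have e : (fun y => fderiv ℝ (fun y => f (a y)) y Y) =ᶠ[𝓝 p] fun y => fderiv ℝ f (a y) (A Y) := by
    filter_upwards [(ha p).continuousAt.eventually (eventually_differentiableAt hf)] with y hy
    exact h1 hy Y
  rw [fderiv_fderiv_apply hfa, e.fderiv_eq, fderiv_fderiv_apply hf]
  exact congrArg (fun L : E →L[ℝ] V => L X)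
    ((differentiableAt_fderiv_apply hf (A Y)).hasFDerivAt.comp p (ha p)).fderiv

theorem fderiv_const_add_clm {ζ : E → W} {p : E} (T : W →L[ℝ] V) (a : V) (hζ : ContDiffAt ℝ 2 ζ p)
    (X Y : E) :
    fderiv ℝ (fun y => a + T (ζ y)) p X = T (fderiv ℝ ζ p X) ∧
    fderiv ℝ (fderiv ℝ (fun y => a + T (ζ y))) p X Y = T (fderiv ℝ (fderiv ℝ ζ) p X Y) := by
  have h1 : ∀ {y}, DifferentiableAt ℝ ζ y → ∀ Z,
      fderiv ℝ (fun y => a + T (ζ y)) y Z = T (fderiv ℝ ζ y Z) := fun {y} h Z =>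
    congrArg (fun L : E →L[ℝ] V => L Z) ((T.hasFDerivAt.comp y h.hasFDerivAt).const_add a).fderiv
  refine ⟨h1 (hζ.differentiableAt (by norm_num)) X, ?_⟩
  have hT : ContDiffAt ℝ 2 (fun y => a + T (ζ y)) p :=
    contDiffAt_const.add (T.contDiff.contDiffAt.comp p hζ)
  have e : (fun y => fderiv ℝ (fun y => a + T (ζ y)) y Y) =ᶠ[𝓝 p] fun y => T (fderiv ℝ ζ y Y) := by
    filter_upwards [eventually_differentiableAt hζ] with y hy
    exact h1 hy Y
  rw [fderiv_fderiv_apply hT, e.fderiv_eq, fderiv_fderiv_apply hζ]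
  exact congrArg (fun L : E →L[ℝ] V => L X)
    (T.hasFDerivAt.comp p (differentiableAt_fderiv_apply hζ Y).hasFDerivAt).fderiv

theorem fderiv_slice_right {g : ℝ × E → V} {s : ℝ} {p : E} (hg : ContDiffAt ℝ 2 g (s, p)) (X Y : E) :
    fderiv ℝ g (s, p) (0, X) = fderiv ℝ (fun y => g (s, y)) p X ∧
    fderiv ℝ (fderiv ℝ g) (s, p) (0, X) (0, Y) = fderiv ℝ (fderiv ℝ (fun y => g (s, y))) p X Y := by
  obtain ⟨h1, h2⟩ := fderiv_comp_affine (f := g) (a := fun y => (s, y))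
    (fun y => hasFDerivAt_prodMk_right s y) hg X Y
  exact ⟨h1.symm, h2.symm⟩

/-- The derivatives in the direction of `ℝ`, from those of a slice; `c'` has to be its derivative at all
times. -/
theorem fderiv_slice_left {g : ℝ × E → V} {s : ℝ} {p : E} (hg : ContDiffAt ℝ 2 g (s, p))
    {c' : ℝ → V} {c'' : V} (h' : ∀ t, HasDerivAt (fun t => g (t, p)) (c' t) t)
    (h'' : HasDerivAt c' c'' s) :
    fderiv ℝ g (s, p) (1, 0) = c' s ∧ fderiv ℝ (fderiv ℝ g) (s, p) (1, 0) (1, 0) = c'' := by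
  obtain ⟨h1, h2⟩ := fderiv_comp_affine (f := g) (a := fun t => (t, p))
    (fun t => hasFDerivAt_prodMk_left t p) hg (1 : ℝ) 1
  refine ⟨h1.symm.trans (by simp [(h' s).deriv]), h2.symm.trans ?_⟩
  have hcomp : ContDiffAt ℝ 2 (fun t => g (t, p)) s :=
    hg.comp s (contDiff_prodMk_left p).contDiffAt
  rw [fderiv_fderiv_apply hcomp]
  have e : (fun t => fderiv ℝ (fun t => g (t, p)) t 1) = c' := funext fun t => by
    simp [(h' t).deriv]
  rw [e]
  simp [h''.deriv]

/-- The vertical part of the second derivative of a horizontal map, by differentiating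
`(DG(Y), G) = 0`. -/
theorem herm_fderiv_fderiv_of_horizontal {n : ℕ} {ε : ℝ} {G : E → CVec (n + 1)} {p : E}
    (hG : ContDiffAt ℝ 2 G p)
    (hhor : ∀ᶠ y in 𝓝 p, ∀ X, herm ε (fderiv ℝ G y X) (G y) = 0) (X Y : E) :
    herm ε (fderiv ℝ (fderiv ℝ G) p X Y) (G p) = -herm ε (fderiv ℝ G p Y) (fderiv ℝ G p X) := by
  have e : (fun y => herm ε (fderiv ℝ G y Y) (G y)) =ᶠ[𝓝 p] fun _ => 0 := by
    filter_upwards [hhor] with y hy using hy Y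
  have h := fderiv_herm ε (differentiableAt_fderiv_apply hG Y) (hG.differentiableAt (by norm_num)) X
  rw [e.fderiv_eq, ← fderiv_fderiv_apply hG] at h
  simp only [fderiv_fun_const, Pi.zero_apply, zero_apply] at h
  linear_combination -h

end Partial

/-! ### Minimal Lagrangian immersions from a planar curve and a minimal Lagrangian immersion -/

section Join

variable {m : ℕ} {ε : ℝ}

/-- A pair of plane curves `(u, v)` for which `s ↦ (u(s) z, v(s))` is horizontal and has unit speed
for the Hermitian form, and whose curvature in the direction `J ∂ₛ` balances the mean curvature of the
`m`-dimensional slices `u(s) N`. -/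
structure IsProfileCurve (m : ℕ) (ε : ℝ) (u v : ℝ → ℂ) : Prop where
  smooth_left : ContDiff ℝ ∞ u
  smooth_right : ContDiff ℝ ∞ v
  ne_zero : ∀ s, u s ≠ 0
  horizontal : ∀ s, deriv u s * conj (u s) = deriv v s * conj (v s)
  unit_speed : ∀ s, deriv u s * conj (deriv u s) - deriv v s * conj (deriv v s) = ε
  balance : ∀ s, ε * (deriv (deriv u) s * conj (deriv u s)
      - deriv (deriv v) s * conj (deriv v s)).im
    + m * (deriv u s * conj (u s)).im / ‖u s‖ ^ 2 = 0

theorem hasDerivAt_deriv_of_smooth {u : ℝ → ℂ} (hu : ContDiff ℝ ∞ u) (s : ℝ) :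
    HasDerivAt u (deriv u s) s ∧ HasDerivAt (deriv u) (deriv (deriv u) s) s := by
  have h2 := (contDiff_infty_iff_deriv.1 hu).2
  exact ⟨(hu.differentiable (by simp) s).hasDerivAt, (h2.differentiable (by simp) s).hasDerivAt⟩

/-- The jet of `(s, y) ↦ J(u(s) ζ(y), v(s))`, for a linear map `J` which is isometric for the forms
`(z, z')_ε - ε a b̄` and `(,)_{-1}`. -/
theorem join_jet {E : Type*} [NormedAddCommGroup E] [NormedSpace ℝ E] [FiniteDimensional ℝ E]
    (hε : ε = 1 ∨ ε = -1) (hdim : Module.finrank ℝ E = m)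
    {J : CVec (m + 1) × ℂ →L[ℝ] CVec (m + 2)}
    (hJ : ∀ z w a b, herm (-1) (J (z, a)) (J (w, b)) = herm ε z w - ε * (a * conj b))
    {u v : ℝ → ℂ} (huv : IsProfileCurve m ε u v) {ζ : E → CVec (m + 1)} {p : E}
    (hζ : ContDiffAt ℝ 2 ζ p) (hz : herm ε (ζ p) (ζ p) = ε)
    (hhor : ∀ᶠ y in 𝓝 p, ∀ X, herm ε (fderiv ℝ ζ y X) (ζ y) = 0)
    (hjet : IsMinimalJet (hermCLM ε m) (fderiv ℝ ζ p) (fderiv ℝ (fderiv ℝ ζ) p)) (s : ℝ) :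
    let g : ℝ × E → CVec (m + 2) := fun q => J (u q.1 • ζ q.2, v q.1)
    (∀ X, herm (-1) (fderiv ℝ g (s, p) X) (g (s, p)) = 0) ∧
    IsMinimalJet (hermCLM (-1) (m + 1)) (fderiv ℝ g (s, p)) (fderiv ℝ (fderiv ℝ g) (s, p)) := by
  intro g
  have hεε : (ε : ℂ) * ε = 1 := by rcases hε with rfl | rfl <;> simp
  have hg : ContDiffAt ℝ 2 g (s, p) := by
    have hu := (huv.smooth_left.of_le (WithTop.coe_le_coe.2 le_top) : ContDiff ℝ 2 u)
    have hv := (huv.smooth_right.of_le (WithTop.coe_le_coe.2 le_top) : ContDiff ℝ 2 v)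
    refine J.contDiff.contDiffAt.comp _ (ContDiffAt.prodMk (ContDiffAt.fun_smul ?_ ?_) ?_)
    · exact hu.contDiffAt.comp _ contDiffAt_fst
    · exact ContDiffAt.comp (s, p) hζ contDiffAt_snd
    · exact hv.contDiffAt.comp _ contDiffAt_fst
  have hJd : ∀ {a b : ℝ → ℂ} {a' b' : ℂ} {t : ℝ}, HasDerivAt a a' t → HasDerivAt b b' t →
      HasDerivAt (fun t => J (a t • ζ p, b t)) (J (a' • ζ p, b')) t := fun ha hb =>
    J.hasFDerivAt.comp_hasDerivAt _ ((ha.smul_const (ζ p)).prodMk hb)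
  obtain ⟨hs, hss⟩ := fderiv_slice_left hg (c' := fun t => J (deriv u t • ζ p, deriv v t))
    (c'' := J (deriv (deriv u) s • ζ p, deriv (deriv v) s))
    (fun t => hJd (hasDerivAt_deriv_of_smooth huv.smooth_left t).1
      (hasDerivAt_deriv_of_smooth huv.smooth_right t).1)
    (hJd (hasDerivAt_deriv_of_smooth huv.smooth_left s).2
      (hasDerivAt_deriv_of_smooth huv.smooth_right s).2)
  let T : CVec (m + 1) →L[ℝ] CVec (m + 2) :=
    J ∘L (ContinuousLinearMap.inl ℝ _ _) ∘L (ContinuousLinearMap.lsmul ℝ ℂ (u s))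
  have hT : ∀ z, T z = J (u s • z, 0) := fun z => rfl
  have hgT : (fun y => g (s, y)) = fun y => J (0, v s) + T (ζ y) := by
    funext y
    rw [hT, ← map_add]
    simp [g]
  have hr : ∀ X Y, fderiv ℝ g (s, p) (0, X) = J (u s • fderiv ℝ ζ p X, 0) ∧
      fderiv ℝ (fderiv ℝ g) (s, p) (0, X) (0, Y) = J (u s • fderiv ℝ (fderiv ℝ ζ) p X Y, 0) := by
    intro X Y
    obtain ⟨h1, h2⟩ := fderiv_slice_right hg X Y
    rw [hgT] at h1 h2
    obtain ⟨h3, h4⟩ := fderiv_const_add_clm T (J (0, v s)) hζ X Y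
    exact ⟨h1.trans h3, h2.trans h4⟩
  have hr1 := fun X => (hr X X).1
  have hr2 := fun X => (hr X X).2
  have hp := hhor.self_of_nhds
  have hp' : ∀ X, herm ε (ζ p) (fderiv ℝ ζ p X) = 0 := fun X => by
    rw [← conj_herm, hp, map_zero]
  have hself : u s * conj (u s) = ((‖u s‖ ^ 2 : ℝ) : ℂ) := by
    rw [Complex.mul_conj, Complex.normSq_eq_norm_sq]
  refine ⟨?_, isMinimalJet_prod (c := ‖u s‖) (κ := (deriv u s * conj (u s)).im) (conj_herm (-1)) hjet
    (norm_ne_zero_iff.2 (huv.ne_zero s)) ?_ ?_ ?_ ?_ ?_ ?_ ?_⟩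
  · rintro ⟨t, X⟩
    have hX : ((t, X) : ℝ × E) = t • ((1 : ℝ), (0 : E)) + ((0 : ℝ), X) := by simp
    rw [hX, map_add, map_smul, hs, hr1, herm_add_left, herm_real_smul_left, hJ, hJ, herm_smul_smul,
      herm_smul_smul, hp, hz]
    linear_combination t * ε * huv.horizontal s
  · rw [hs, hermCLM_apply, hJ, herm_smul_smul, hz]
    linear_combination ε * huv.unit_speed s + hεε
  · intro X
    rw [hs, hr1, hermCLM_apply, hJ, herm_smul_smul, hp']
    simp
  · intro X Y
    rw [hr1, hr1, hermCLM_apply, hJ, herm_smul_smul, hself]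
    simp
  · intro X
    rw [hss, hr1, hermCLM_apply, hJ, herm_smul_smul, hp']
    simp
  · intro X Y
    rw [hr1, hr2, hermCLM_apply, hJ, herm_smul_smul, hself, map_zero, mul_zero, mul_zero, sub_zero,
      Complex.im_ofReal_mul]
    rfl
  · intro X
    rw [hs, hr2, hermCLM_apply, hJ, herm_smul_smul, herm_fderiv_fderiv_of_horizontal hζ hhor,
      herm_self_eq_re]
    simp
    ring
  · rw [hs, hss, hermCLM_apply, hJ, herm_smul_smul, hz, hdim, ← huv.balance s]
    congr 1
    rw [← Complex.im_ofReal_mul]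
    congr 1
    ring

end Join

/-! ### Products of the line and a manifold -/

section ProductManifold

variable {E H N : Type*} [NormedAddCommGroup E] [NormedSpace ℝ E] [FiniteDimensional ℝ E]
  [TopologicalSpace H] [TopologicalSpace N] [ChartedSpace H N] {I : ModelWithCorners ℝ E H}
  [I.Boundaryless] {m : ℕ}

/-- Only a chart of `N` is needed to verify that a horizontal map `ℝ × N → ℍ₁` projects to a minimal
Lagrangian immersion, since `ℝ` is its own chart. -/
theorem isMinimalLagrangian_of_prod_chart {Gl : ℝ × N → Quadric (-1) (m + 1)}
    (hG : ContMDiff (𝓘(ℝ, ℝ).prod I) 𝓘(ℝ, CVec (m + 2)) ∞ fun q => (Gl q).1)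
    (hdim : Module.finrank ℝ E = m)
    (h : ∀ (s : ℝ) (x : N),
      let g : ℝ × E → CVec (m + 2) := fun q => (Gl (q.1, (extChartAt I x).symm q.2)).1
      (∀ X, herm (-1) (fderiv ℝ g (s, extChartAt I x x) X) (g (s, extChartAt I x x)) = 0) ∧
      IsMinimalJet (hermCLM (-1) (m + 1)) (fderiv ℝ g (s, extChartAt I x x))
        (fderiv ℝ (fderiv ℝ g) (s, extChartAt I x x))) :
    IsMinimalLagrangian (𝓘(ℝ, ℝ).prod I) fun q => hopf (Gl q) := by
  have hcoord : ∀ (s : ℝ) (x : N),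
      ((fun q => (Gl q).1) ∘ (extChartAt (𝓘(ℝ, ℝ).prod I) (s, x)).symm)
        = fun q : ℝ × E => (Gl (q.1, (extChartAt I x).symm q.2)).1 := by
    intro s x
    rw [extChartAt_prod]
    rfl
  have hpt : ∀ (s : ℝ) (x : N),
      extChartAt (𝓘(ℝ, ℝ).prod I) (s, x) (s, x) = (s, extChartAt I x x) := by
    intro s x
    rw [extChartAt_prod]
    rfl
  refine isMinimalLagrangian_of_isMinimalJet (Or.inr rfl) hG (by simp [hdim, add_comm]) ?_ ?_
  · rintro ⟨s, x⟩ X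
    rw [hcoord, hpt]
    have := (h s x).1 X
    dsimp only at this
    rwa [extChartAt_to_inv] at this
  · rintro ⟨s, x⟩
    rw [hcoord, hpt]
    exact (h s x).2

variable [IsManifold I ∞ N] {ε : ℝ}

/-- A minimal Lagrangian immersion of `N` and a profile curve give a minimal Lagrangian immersion of
`ℝ × N`. The isometry `J` covers both orders of the coordinates. -/
theorem isMinimalLagrangian_join (hε : ε = 1 ∨ ε = -1) (hdim : Module.finrank ℝ E = m)
    {J : CVec (m + 1) × ℂ →L[ℝ] CVec (m + 2)}
    (hJ : ∀ z w a b, herm (-1) (J (z, a)) (J (w, b)) = herm ε z w - ε * (a * conj b))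
    {u v : ℝ → ℂ} (huv : IsProfileCurve m ε u v) {φ : N → HopfBase ε m}
    (hφ : IsMinimalLagrangian I φ) {φl : N → Quadric ε m} (hl : IsHorizontalLift I φl φ)
    {Gl : ℝ × N → Quadric (-1) (m + 1)}
    (hGl : ∀ q, (Gl q).1 = J (u q.1 • (φl q.2).1, v q.1)) :
    IsMinimalLagrangian (𝓘(ℝ, ℝ).prod I) fun q => hopf (Gl q) := by
  refine isMinimalLagrangian_of_prod_chart ?_ hdim fun s x => ?_
  · have hΘ : ContDiff ℝ ∞ fun q : ℝ × CVec (m + 1) => J (u q.1 • q.2, v q.1) :=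
      J.contDiff.comp (((huv.smooth_left.comp contDiff_fst).smul contDiff_snd).prodMk
        (huv.smooth_right.comp contDiff_fst))
    simp_rw [hGl]
    exact hΘ.contMDiff.comp (contMDiff_fst.prodMk_space (hl.smooth.comp contMDiff_snd))
  · simp only [hGl]
    have hφl : MDifferentiable I 𝓘(ℝ, CVec (m + 1)) fun x => (φl x).1 :=
      hl.smooth.mdifferentiable (by simp)
    have hhor : ∀ᶠ y in 𝓝 (extChartAt I x x), ∀ X,
        herm ε (fderiv ℝ ((fun x => (φl x).1) ∘ (extChartAt I x).symm) y X)
          (((fun x => (φl x).1) ∘ (extChartAt I x).symm) y) = 0 := by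
      filter_upwards [eventually_mem_target (I := I) x] with y hy X
      rw [(chart_fderiv hy (hφl _)).2]
      exact hl.horizontal _ _
    have hinv : (extChartAt I x).symm (extChartAt I x x) = x := extChartAt_to_inv x
    have hval : ((fun y => (φl y).1) ∘ (extChartAt I x).symm) (extChartAt I x x) = (φl x).1 := by
      rw [Function.comp_apply, hinv]
    refine join_jet hε hdim hJ huv
      ((contMDiffAt_iff_chart.1 (hl.smooth x)).2.of_le (WithTop.coe_le_coe.2 le_top))
      (by rw [hval]; exact (φl x).2) hhor
      (isMinimalJet_of_isMinimalLagrangian hε hφ hl x ?_) s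
    have := hhor.self_of_nhds
    rwa [hval] at this

end ProductManifold

/-! ### The profile curves -/

section Polar

/-- The derivatives of a plane curve in polar coordinates. -/
theorem polar_derivs {R R₁ θ θ₁ : ℝ → ℝ} {R₂ θ₂ s : ℝ} (hR : ∀ t, HasDerivAt R (R₁ t) t)
    (hR₁ : HasDerivAt R₁ R₂ s) (hθ : ∀ t, HasDerivAt θ (θ₁ t) t) (hθ₁ : HasDerivAt θ₁ θ₂ s) :
    deriv (fun t => (R t : ℂ) * Complex.exp (θ t * Complex.I)) s
      = Complex.mk (R₁ s) (R s * θ₁ s) * Complex.exp (θ s * Complex.I) ∧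
    deriv (deriv fun t => (R t : ℂ) * Complex.exp (θ t * Complex.I)) s
      = Complex.mk (R₂ - R s * θ₁ s ^ 2) (2 * R₁ s * θ₁ s + R s * θ₂)
        * Complex.exp (θ s * Complex.I) := by
  have hexp : ∀ t, HasDerivAt (fun t => Complex.exp (θ t * Complex.I))
      (Complex.exp (θ t * Complex.I) * (θ₁ t * Complex.I)) t := fun t =>
    ((hθ t).ofReal_comp.mul_const Complex.I).cexp
  have h1 : ∀ t, HasDerivAt (fun t => (R t : ℂ) * Complex.exp (θ t * Complex.I))
      ((R₁ t + R t * θ₁ t * Complex.I) * Complex.exp (θ t * Complex.I)) t := fun t => by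
    refine ((hR t).ofReal_comp.mul (hexp t)).congr_deriv ?_
    ring
  refine ⟨(h1 s).deriv.trans ?_, ?_⟩
  · rw [Complex.mk_eq_add_mul_I]
    push_cast
    rfl
  rw [show deriv (fun t => (R t : ℂ) * Complex.exp (θ t * Complex.I)) = _ from
    funext fun t => (h1 t).deriv]
  refine HasDerivAt.deriv ((((hR₁.ofReal_comp.add
    (((hR s).ofReal_comp.mul hθ₁.ofReal_comp).mul_const Complex.I)).mul (hexp s))).congr_deriv ?_)
  simp only [Pi.add_apply, Pi.mul_apply, Complex.mk_eq_add_mul_I]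
  push_cast
  linear_combination (R s * θ₁ s ^ 2 * Complex.exp (θ s * Complex.I)) * Complex.I_sq

theorem mul_exp_mul_conj (a b : ℂ) (θ : ℝ) :
    a * Complex.exp (θ * Complex.I) * conj (b * Complex.exp (θ * Complex.I)) = a * conj b := by
  rw [map_mul]
  linear_combination a * conj b * expI_mul_conj θ

end Polar

theorem contDiff_integral {f : ℝ → ℝ} (hf : ContDiff ℝ ∞ f) (c : ℝ) :
    (∀ s, HasDerivAt (fun s => c * ∫ t in (0 : ℝ)..s, f t) (c * f s) s) ∧
      ContDiff ℝ ∞ fun s => c * ∫ t in (0 : ℝ)..s, f t := by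
  have h : ∀ s, HasDerivAt (fun s => c * ∫ t in (0 : ℝ)..s, f t) (c * f s) s := fun s =>
    (hf.continuous.integral_hasStrictDerivAt 0 s).hasDerivAt.const_mul c
  refine ⟨h, contDiff_infty_iff_deriv.2 ⟨fun s => (h s).differentiableAt, ?_⟩⟩
  rw [show deriv (fun s => c * ∫ t in (0 : ℝ)..s, f t) = _ from funext fun s => (h s).deriv]
  exact contDiff_const.mul hf

section ProfileODE

variable {m : ℕ} {ε : ℝ} {σ τ r : ℝ → ℝ} {ρ : ℝ}

/-- The first integral `(1 - (r')²) σ(r)²ⁿ τ(r)²` of the profile equation, `n = m + 1`; the two cases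
are `(σ, τ) = (sinh, cosh)` and `(σ, τ) = (cosh, sinh)`. -/
theorem profile_first_integral (hσ : ∀ x, HasDerivAt σ (τ x) x) (hτ : ∀ x, HasDerivAt τ (σ x) x)
    (hr : Differentiable ℝ r) (hr' : Differentiable ℝ (deriv r))
    (hode : ∀ s, deriv (deriv r) s * (σ (r s) * τ (r s))
      = (1 - deriv r s ^ 2) * (σ (r s) ^ 2 + (m + 1) * τ (r s) ^ 2))
    (h0 : r 0 = ρ) (h0' : deriv r 0 = 0) (s : ℝ) :
    (1 - deriv r s ^ 2) * (σ (r s) ^ (m + 1) * τ (r s)) ^ 2 = (σ ρ ^ (m + 1) * τ ρ) ^ 2 := by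
  have hd : ∀ s, HasDerivAt
      (fun s => (1 - deriv r s ^ 2) * (σ (r s) ^ (m + 1) * τ (r s)) ^ 2) 0 s := by
    intro s
    have h1 := (hσ (r s)).comp s (hr s).hasDerivAt
    have h2 := (hτ (r s)).comp s (hr s).hasDerivAt
    have h3 := (((hr' s).hasDerivAt.pow 2).const_sub 1).mul (((h1.pow (m + 1)).mul h2).pow 2)
    refine h3.congr_deriv ?_
    simp
    linear_combination (-2 * deriv r s * σ (r s) ^ (2 * m + 1) * τ (r s)) * hode s
  have := is_const_of_deriv_eq_zero (fun s => (hd s).differentiableAt) (fun s => (hd s).deriv) s 0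
  simpa [h0, h0'] using this

/-- Solutions of the profile equation are smooth, because the equation can be solved for `r''`. -/
theorem contDiff_profile (hσ : ContDiff ℝ ∞ σ) (hτ : ContDiff ℝ ∞ τ)
    (hr : Differentiable ℝ r) (hr' : Differentiable ℝ (deriv r))
    (hode : ∀ s, deriv (deriv r) s * (σ (r s) * τ (r s))
      = (1 - deriv r s ^ 2) * (σ (r s) ^ 2 + (m + 1) * τ (r s) ^ 2))
    (hne : ∀ s, σ (r s) * τ (r s) ≠ 0) : ContDiff ℝ ∞ r := by
  have hr2 : deriv (deriv r) = fun s =>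
      (1 - deriv r s ^ 2) * (σ (r s) ^ 2 + (m + 1) * τ (r s) ^ 2) / (σ (r s) * τ (r s)) :=
    funext fun s => by rw [eq_div_iff (hne s), hode]
  have key : ∀ k : ℕ, ContDiff ℝ (k + 1) r := by
    intro k
    induction k with
    | zero =>
      simpa using contDiff_one_iff_deriv.2 ⟨hr, hr'.continuous⟩
    | succ k ih =>
      have h1 : ContDiff ℝ k (deriv r) := (contDiff_succ_iff_deriv.1 ih).2.2
      have h0 : ContDiff ℝ k r := ih.of_le (by exact_mod_cast Nat.le_succ k)
      have hσr : ContDiff ℝ k fun s => σ (r s) :=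
        (hσ.of_le (WithTop.coe_le_coe.2 le_top)).comp h0
      have hτr : ContDiff ℝ k fun s => τ (r s) :=
        (hτ.of_le (WithTop.coe_le_coe.2 le_top)).comp h0
      have h2 : ContDiff ℝ k (deriv (deriv r)) := by
        rw [hr2]
        exact ((contDiff_const.sub (h1.pow 2)).mul
          ((hσr.pow 2).add (contDiff_const.mul (hτr.pow 2)))).div (hσr.mul hτr) hne
      have h3 : ContDiff ℝ (k + 1) (deriv r) :=
        contDiff_succ_iff_deriv.2 ⟨hr', by simp, h2⟩
      have h4 : ContDiff ℝ ((k : ℕ∞ω) + 1 + 1) r := contDiff_succ_iff_deriv.2 ⟨hr, by simp, h3⟩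
      exact_mod_cast h4
  exact contDiff_infty.2 fun k => (key k).of_le (by exact_mod_cast Nat.le_succ k)

/-- The curvature computation: `t = r'`, `q = r''`, and `A`, `B = A σ² / τ²` are the angular
velocities of the two components. -/
theorem profile_balance {M S T t q A : ℝ} (hS : S ≠ 0) (hT : T ≠ 0)
    (hq : q * (S * T) = (1 - t ^ 2) * (S ^ 2 + (M + 1) * T ^ 2))
    (hA : A ^ 2 * S ^ 2 = (1 - t ^ 2) * T ^ 2) :
    (T * t * (2 * (T * t) * A + S * (-(M + 2) * A * T * t / S))
        - S * A * (S * t ^ 2 + T * q - S * A ^ 2))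
      - (S * t * (2 * (S * t) * (A * S ^ 2 / T ^ 2)
          + T * (-(M + 2) * A * S * t / T + 2 * A * S * t / T - 2 * A * S ^ 3 * t / T ^ 3))
        - T * (A * S ^ 2 / T ^ 2) * (T * t ^ 2 + S * q - T * (A * S ^ 2 / T ^ 2) ^ 2))
      = -(M * A * (T ^ 2 - S ^ 2)) := by
  rw [← sub_eq_zero]
  have key : ∀ x y : ℝ, x = 0 → y = 0 →
      A * (T ^ 2 - S ^ 2) * (-x / T ^ 2 + y * (T ^ 2 + S ^ 2) / T ^ 4) = 0 := by
    rintro x y rfl rfl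
    simp
  rw [← key _ _ (sub_eq_zero.2 hq) (sub_eq_zero.2 hA)]
  field_simp
  ring

/-- The profile curves of the solutions of the profile equation: `1 - (r')² = σ(r)² A² / τ(r)²`, where
`A = a / σ(r)ⁿ⁺¹` is the angular velocity of the first component, by the first integral. -/
theorem isProfileCurve_of_ode (hε : ε = 1 ∨ ε = -1) (hσs : ContDiff ℝ ∞ σ) (hτs : ContDiff ℝ ∞ τ)
    (hσ : ∀ x, HasDerivAt σ (τ x) x) (hτ : ∀ x, HasDerivAt τ (σ x) x)
    (hστ : ∀ x, τ x ^ 2 - σ x ^ 2 = ε)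
    (hr : Differentiable ℝ r) (hr' : Differentiable ℝ (deriv r))
    (hode : ∀ s, deriv (deriv r) s * (σ (r s) * τ (r s))
      = (1 - deriv r s ^ 2) * (σ (r s) ^ 2 + (m + 1) * τ (r s) ^ 2))
    (h0 : r 0 = ρ) (h0' : deriv r 0 = 0) (hσρ : σ ρ ≠ 0) (hτρ : τ ρ ≠ 0) :
    IsProfileCurve m ε
      (fun s => σ (r s) * Complex.exp
        ((τ ρ * σ ρ ^ (m + 1) * ∫ t in (0 : ℝ)..s, 1 / σ (r t) ^ (m + 2) : ℝ) * Complex.I))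
      (fun s => τ (r s) * Complex.exp ((τ ρ * σ ρ ^ (m + 1) *
        ∫ t in (0 : ℝ)..s, (σ (r t) / τ (r t)) ^ 2 / σ (r t) ^ (m + 2) : ℝ) * Complex.I)) := by
  have hint := profile_first_integral hσ hτ hr hr' hode h0 h0'
  have hne : ∀ s, σ (r s) ≠ 0 ∧ τ (r s) ≠ 0 := by
    intro s
    have : (1 - deriv r s ^ 2) * (σ (r s) ^ (m + 1) * τ (r s)) ^ 2 ≠ 0 := by
      rw [hint s]
      exact pow_ne_zero _ (mul_ne_zero (pow_ne_zero _ hσρ) hτρ)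
    constructor <;> rintro h <;> simp [h] at this
  have hσ0 := fun s => (hne s).1
  have hτ0 := fun s => (hne s).2
  have hrs : ContDiff ℝ ∞ r := contDiff_profile hσs hτs hr hr' hode
    fun s => mul_ne_zero (hσ0 s) (hτ0 s)
  have hS : ContDiff ℝ ∞ fun s => σ (r s) := hσs.comp hrs
  have hT : ContDiff ℝ ∞ fun s => τ (r s) := hτs.comp hrs
  set a := τ ρ * σ ρ ^ (m + 1) with ha
  have hα1 : ContDiff ℝ ∞ fun s => 1 / σ (r s) ^ (m + 2) :=
    contDiff_const.div (hS.pow _) fun s => pow_ne_zero _ (hσ0 s)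
  have hβ1 : ContDiff ℝ ∞ fun s => (σ (r s) / τ (r s)) ^ 2 / σ (r s) ^ (m + 2) :=
    ((hS.div hT hτ0).pow 2).div (hS.pow _) fun s => pow_ne_zero _ (hσ0 s)
  obtain ⟨dα, hα⟩ := contDiff_integral hα1 a
  obtain ⟨dβ, hβ⟩ := contDiff_integral hβ1 a
  set α := fun s => a * ∫ t in (0 : ℝ)..s, 1 / σ (r t) ^ (m + 2)
  set β := fun s => a * ∫ t in (0 : ℝ)..s, (σ (r t) / τ (r t)) ^ 2 / σ (r t) ^ (m + 2)
  have dS : ∀ s, HasDerivAt (fun s => σ (r s)) (τ (r s) * deriv r s) s := fun s =>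
    (hσ (r s)).comp s (hr s).hasDerivAt
  have dT : ∀ s, HasDerivAt (fun s => τ (r s)) (σ (r s) * deriv r s) s := fun s =>
    (hτ (r s)).comp s (hr s).hasDerivAt
  have dS' : ∀ s, HasDerivAt (fun s => τ (r s) * deriv r s)
      (σ (r s) * deriv r s * deriv r s + τ (r s) * deriv (deriv r) s) s := fun s =>
    (dT s).mul (hr' s).hasDerivAt
  have dT' : ∀ s, HasDerivAt (fun s => σ (r s) * deriv r s)
      (τ (r s) * deriv r s * deriv r s + σ (r s) * deriv (deriv r) s) s := fun s =>
    (dS s).mul (hr' s).hasDerivAt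
  obtain ⟨A, hAdef⟩ : ∃ A : ℝ → ℝ, A = fun s => a * (1 / σ (r s) ^ (m + 2)) := ⟨_, rfl⟩
  obtain ⟨B, hBdef⟩ : ∃ B : ℝ → ℝ, B = fun s => a * ((σ (r s) / τ (r s)) ^ 2 / σ (r s) ^ (m + 2)) :=
    ⟨_, rfl⟩
  replace dα : ∀ s, HasDerivAt α (A s) s := hAdef ▸ dα
  replace dβ : ∀ s, HasDerivAt β (B s) s := hBdef ▸ dβ
  have hB : ∀ s, B s = A s * σ (r s) ^ 2 / τ (r s) ^ 2 := fun s => by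
    simp only [hAdef, hBdef]
    ring
  have dA : ∀ s, HasDerivAt A (-((m : ℝ) + 2) * A s * τ (r s) * deriv r s / σ (r s)) s := by
    intro s
    have := (((dS s).pow (m + 2)).inv (pow_ne_zero _ (hσ0 s))).const_mul a
    simp only [hAdef, one_div]
    refine this.congr_deriv ?_
    have := hσ0 s
    simp
    field_simp
    ring
  have dB : ∀ s, HasDerivAt B (-((m : ℝ) + 2) * A s * σ (r s) * deriv r s / τ (r s)
      + 2 * A s * σ (r s) * deriv r s / τ (r s)
      - 2 * A s * σ (r s) ^ 3 * deriv r s / τ (r s) ^ 3) s := by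
    intro s
    have := ((dA s).mul ((dS s).pow 2)).div ((dT s).pow 2) (pow_ne_zero _ (hτ0 s))
    rw [show B = fun s => A s * σ (r s) ^ 2 / τ (r s) ^ 2 from funext hB]
    refine this.congr_deriv ?_
    have := hσ0 s
    have := hτ0 s
    simp
    field_simp
  -- The first integral, in terms of the angular velocity `A`.
  have hA2 : ∀ s, A s ^ 2 * σ (r s) ^ 2 = (1 - deriv r s ^ 2) * τ (r s) ^ 2 := by
    intro s
    have h := hint s
    have := hσ0 s
    have ha2 : a ^ 2 = (σ ρ ^ (m + 1) * τ ρ) ^ 2 := by rw [ha]; ring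
    simp only [hAdef, mul_pow, ha2, ← h]
    field_simp
    ring
  have hu := fun s => polar_derivs dS (dS' s) dα (dA s)
  have hv := fun s => polar_derivs dT (dT' s) dβ (dB s)
  have hexp : ∀ θ : ℝ → ℝ, ContDiff ℝ ∞ θ →
      ContDiff ℝ ∞ fun s => Complex.exp (θ s * Complex.I) := fun θ hθ =>
    ((Complex.ofRealCLM.contDiff.comp hθ).mul contDiff_const).cexp
  refine ⟨(Complex.ofRealCLM.contDiff.comp hS).mul (hexp α hα),
    (Complex.ofRealCLM.contDiff.comp hT).mul (hexp β hβ), fun s => ?_, fun s => ?_, fun s => ?_,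
    fun s => ?_⟩
  · exact mul_ne_zero (by exact_mod_cast hσ0 s) (Complex.exp_ne_zero _)
  · rw [(hu s).1, (hv s).1, mul_exp_mul_conj, mul_exp_mul_conj]
    have e : σ (r s) ^ 2 * A s = τ (r s) ^ 2 * B s := by
      rw [hB]
      have := hτ0 s
      field_simp
    refine Complex.ext ?_ ?_
    · simp
      ring
    · simp
      linear_combination e
  · rw [(hu s).1, (hv s).1, mul_exp_mul_conj, mul_exp_mul_conj, Complex.mul_conj, Complex.mul_conj,
      ← hστ (r s)]
    norm_cast
    rw [Complex.normSq_mk, Complex.normSq_mk]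
    have e : τ (r s) ^ 2 * B s ^ 2 * τ (r s) ^ 2 = A s ^ 2 * σ (r s) ^ 2 * σ (r s) ^ 2 := by
      rw [hB]
      have := hτ0 s
      field_simp
    refine mul_right_cancel₀ (pow_ne_zero 2 (hτ0 s)) ?_
    linear_combination (τ (r s) ^ 2 - σ (r s) ^ 2) * hA2 s - e
  · have hnorm : ‖(σ (r s) : ℂ) * Complex.exp ((α s : ℝ) * Complex.I)‖ ^ 2 = σ (r s) ^ 2 := by
      rw [norm_mul, Complex.norm_exp_ofReal_mul_I, mul_one, Complex.norm_real, Real.norm_eq_abs,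
        sq_abs]
    have hbal := profile_balance (hσ0 s) (hτ0 s) (hode s) (hA2 s)
    rw [(hu s).1, (hv s).1, (hu s).2, (hv s).2, mul_exp_mul_conj, mul_exp_mul_conj,
      mul_exp_mul_conj, hnorm]
    rw [hστ, ← hB] at hbal
    have hε2 : ε * ε = 1 := by rcases hε with rfl | rfl <;> simp
    have hlast : (m : ℝ) * (σ (r s) * A s * σ (r s)) / σ (r s) ^ 2 = m * A s := by
      have := hσ0 s
      field_simp
    simp only [Complex.sub_im, Complex.mul_im, Complex.conj_re, Complex.conj_im,
      Complex.ofReal_re, Complex.ofReal_im]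
    rw [neg_zero, mul_zero, zero_add, hlast]
    linear_combination ε * hbal - m * A s * hε2

end ProfileODE

/-! ### Minimal Lagrangian immersions into `ℂᵐ` and their potentials -/

section Flat

variable {m : ℕ}

/-- The Hermitian product of `ℂᵐ` as a continuous `ℝ`-bilinear map. -/
def flatCLM (m : ℕ) : CVec m →L[ℝ] CVec m →L[ℝ] ℂ :=
  (LinearMap.mk₂ ℝ (fun u v : CVec m => ∑ i, u i * conj (v i))
    (fun u u' v => by simp [add_mul, Finset.sum_add_distrib])
    (fun a u v => by simp [Finset.mul_sum, mul_assoc])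
    (fun u v v' => by simp [mul_add, Finset.sum_add_distrib])
    (fun a u v => by simp [Finset.mul_sum, mul_left_comm])).toContinuousBilinearMap

theorem flatCLM_apply (u v : CVec m) : flatCLM m u v = ∑ i, u i * conj (v i) := rfl

theorem flatMetric_eq (w u v : CVec m) : flatMetric w u v = (flatCLM m u v).re := rfl

theorem conj_flatCLM (u v : CVec m) : conj (flatCLM m u v) = flatCLM m v u := by
  simp only [flatCLM_apply, map_sum, map_mul, Complex.conj_conj]
  exact Finset.sum_congr rfl fun i _ => mul_comm _ _

theorem flatCLM_smul_left (a : ℂ) (u v : CVec m) : flatCLM m (a • u) v = a * flatCLM m u v := by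
  simp [flatCLM_apply, Finset.mul_sum, mul_assoc]

theorem flatCLM_smul_right (a : ℂ) (u v : CVec m) :
    flatCLM m u (a • v) = conj a * flatCLM m u v := by
  simp [flatCLM_apply, Finset.mul_sum, mul_left_comm]

theorem flatCLM_self (u : CVec m) : flatCLM m u u = ((‖u‖ ^ 2 : ℝ) : ℂ) := by
  rw [flatCLM_apply, EuclideanSpace.norm_sq_eq]
  push_cast
  exact Finset.sum_congr rfl fun i _ => by
    rw [Complex.mul_conj, Complex.normSq_eq_norm_sq, Complex.ofReal_pow]

/-- For maps into `ℂᵐ` the map itself takes the place of the horizontal lift. -/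
theorem isMinimalJet_of_flat {E H M : Type*} [NormedAddCommGroup E] [NormedSpace ℝ E]
    [FiniteDimensional ℝ E] [TopologicalSpace H] [TopologicalSpace M] [ChartedSpace H M]
    {I : ModelWithCorners ℝ E H} {η : M → CVec m} {x : M}
    (hη : IsMinimalLagrangianAt I flatMetric η x) :
    IsMinimalJet (flatCLM m) (fderiv ℝ (η ∘ (extChartAt I x).symm) (extChartAt I x x))
      (fderiv ℝ (fderiv ℝ (η ∘ (extChartAt I x).symm)) (extChartAt I x x)) := by
  have hlag : ∀ X Y, (flatCLM m (fderiv ℝ (η ∘ (extChartAt I x).symm) (extChartAt I x x) X)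
      (fderiv ℝ (η ∘ (extChartAt I x).symm) (extChartAt I x x) Y)).im = 0 := by
    intro X Y
    have := hη.lagrangian X Y
    rw [flatMetric_eq, flatCLM_smul_left, Complex.I_mul_re] at this
    linarith
  refine isMinimalJet_of_forall conj_flatCLM hlag (fun X hX => ?_) fun e he Y => ?_
  · rw [flatCLM_self, Complex.ofReal_re]
    have := (map_ne_zero_iff _ hη.immersion).2 hX
    positivity
  -- The vector `J η_* Y` is normal to the Lagrangian immersion `η`.
  · have := hη.minimal e he
      (Complex.I • fderiv ℝ (η ∘ (extChartAt I x).symm) (extChartAt I x x) Y) fun X => by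
        rw [flatMetric_eq, flatCLM_smul_right, Complex.conj_I, neg_mul, Complex.neg_re,
          Complex.I_mul_re, hlag, neg_zero, neg_zero]
    have hΓ : ∀ w u v y : CVec m, christoffel flatMetric w u v y = 0 := fun w u v y => by
      simp [christoffel, flatMetric]
    simp only [secondFundamentalForm, hΓ, flatMetric_eq, flatCLM_smul_right, add_zero] at this
    simpa using this

/-- The two equations for `f` say that `df = 2 (η_*, η)`. -/
theorem fderiv_potential {E H N : Type*} [NormedAddCommGroup E] [NormedSpace ℝ E]
    [TopologicalSpace H] [TopologicalSpace N] [ChartedSpace H N]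
    {I : ModelWithCorners ℝ E H} [I.Boundaryless] [IsManifold I ∞ N] {η : N → CVec m}
    (hη : ContMDiff I 𝓘(ℝ, CVec m) ∞ η) {f : N → ℂ} (hf : MDifferentiable I 𝓘(ℝ, ℂ) f)
    (hre : ∀ x, (f x).re = ‖η x‖ ^ 2)
    (him : ∀ (x : N) (v : TangentSpace I x),
      mfderiv I 𝓘(ℝ, ℝ) (fun y => (f y).im) x v
        = 2 * flatMetric (η x) (mfderiv I 𝓘(ℝ, CVec m) η x v) (Complex.I • η x))
    {x : N} {y : E} (hy : y ∈ (extChartAt I x).target) (X : E) :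
    fderiv ℝ (f ∘ (extChartAt I x).symm) y X = 2 * flatCLM m
      (fderiv ℝ (η ∘ (extChartAt I x).symm) y X) ((η ∘ (extChartAt I x).symm) y) := by
  have hηd := chart_fderiv hy (hη.mdifferentiable (by simp) _)
  have hfd := chart_fderiv hy (hf _)
  have himd : MDifferentiable I 𝓘(ℝ, ℝ) fun y => (f y).im :=
    Complex.imCLM.differentiable.mdifferentiable.comp hf
  refine Complex.ext ?_ ?_
  · have h1 := (Complex.reCLM.hasFDerivAt.comp y hfd.1.hasFDerivAt).fderiv
    have h2 := (Complex.reCLM.hasFDerivAt.comp y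
      ((flatCLM m).hasFDerivAt_of_bilinear hηd.1.hasFDerivAt hηd.1.hasFDerivAt)).fderiv
    have e : Complex.reCLM ∘ (f ∘ (extChartAt I x).symm) = Complex.reCLM ∘ fun y =>
        flatCLM m ((η ∘ (extChartAt I x).symm) y) ((η ∘ (extChartAt I x).symm) y) := by
      funext y
      simp only [Function.comp_apply, flatCLM_self, Complex.reCLM_apply, hre, Complex.ofReal_re]
    rw [e] at h1
    have h3 := congrArg (fun L : E →L[ℝ] ℝ => L X) (h1.symm.trans h2)
    change (fderiv ℝ (f ∘ (extChartAt I x).symm) y X).re = (flatCLM m _ _ + flatCLM m _ _).re at h3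
    rw [h3, Complex.add_re, ← conj_flatCLM, Complex.conj_re]
    simp
    ring
  · have h1 := (Complex.imCLM.hasFDerivAt.comp y hfd.1.hasFDerivAt).fderiv
    have h2 := (chart_fderiv hy (himd _)).2 X
    rw [him, ← hηd.2, flatMetric_eq, flatCLM_smul_right] at h2
    have h3 := congrArg (fun L : E →L[ℝ] ℝ => L X) h1
    change _ = (fderiv ℝ (f ∘ (extChartAt I x).symm) y X).im at h3
    refine h3.symm.trans (h2.trans ?_)
    rw [Complex.conj_I, neg_mul, Complex.neg_re, Complex.I_mul_re, neg_neg, Complex.mul_im]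
    simp only [Complex.re_ofNat, Complex.im_ofNat, zero_mul, add_zero]
    rfl

/-- A differentiable solution of `df = 2 (η_*, η)` is smooth, because its derivative is. -/
theorem contMDiff_potential {E H N : Type*} [NormedAddCommGroup E] [NormedSpace ℝ E]
    [TopologicalSpace H] [TopologicalSpace N] [ChartedSpace H N]
    {I : ModelWithCorners ℝ E H} [I.Boundaryless] [IsManifold I ∞ N] {η : N → CVec m}
    (hη : ContMDiff I 𝓘(ℝ, CVec m) ∞ η) {f : N → ℂ} (hf : MDifferentiable I 𝓘(ℝ, ℂ) f)
    (hdf : ∀ x, ∀ y ∈ (extChartAt I x).target, ∀ X, fderiv ℝ (f ∘ (extChartAt I x).symm) y X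
      = 2 * flatCLM m (fderiv ℝ (η ∘ (extChartAt I x).symm) y X)
        ((η ∘ (extChartAt I x).symm) y)) :
    ContMDiff I 𝓘(ℝ, ℂ) ∞ f := by
  intro x
  refine contMDiffAt_iff_chart.2 ⟨hf.continuous.continuousAt, ?_⟩
  have hopen := isOpen_extChartAt_target (I := I) x
  refine ContDiffOn.contDiffAt ?_ (extChartAt_target_mem_nhds x)
  have hηs : ContDiffOn ℝ ∞ (η ∘ (extChartAt I x).symm) (extChartAt I x).target := by
    rw [← contMDiffOn_iff_contDiffOn]
    exact hη.comp_contMDiffOn (contMDiffOn_extChartAt_symm x)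
  refine (contDiffOn_infty_iff_fderiv_of_isOpen hopen).2
    ⟨fun y hy => (chart_fderiv hy (hf _)).1.differentiableWithinAt, ?_⟩
  have hdη := ((contDiffOn_infty_iff_fderiv_of_isOpen hopen).1 hηs).2
  have h2 : ContDiffOn ℝ ∞ (fun y => (2 : ℝ) • ((flatCLM m).flip ((η ∘ (extChartAt I x).symm) y)).comp
      (fderiv ℝ (η ∘ (extChartAt I x).symm) y)) (extChartAt I x).target :=
    contDiffOn_const.fun_smul (((flatCLM m).flip.contDiff.comp_contDiffOn hηs).clm_comp hdη)
  refine h2.congr fun y hy => ?_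
  ext X
  rw [hdf x y hy X]
  simp

end Flat

/-! ### Horospherical immersions -/

section Horospherical

variable {m : ℕ}

theorem snocCoord_add {n : ℕ} (z w : CVec n) (a b : ℂ) :
    snocCoord (z + w) (a + b) = snocCoord z a + snocCoord w b := by
  ext i
  induction i using Fin.lastCases <;> simp [snocCoord]

theorem snocCoord_smul {n : ℕ} (c : ℂ) (z : CVec n) (a : ℂ) :
    snocCoord (c • z) (c * a) = c • snocCoord z a := by
  ext i
  induction i using Fin.lastCases <;> simp [snocCoord]

/-- `(z, a) ↦ (z, a)` as a linear map. -/
def snocCLM (n : ℕ) : CVec n × ℂ →L[ℝ] CVec (n + 1) :=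
  LinearMap.toContinuousLinearMap
    { toFun := fun q => snocCoord q.1 q.2
      map_add' := fun p q => snocCoord_add _ _ _ _
      map_smul' := fun c p => by simpa using snocCoord_smul (c : ℂ) p.1 p.2 }

theorem snocCLM_apply {n : ℕ} (z : CVec n) (a : ℂ) : snocCLM n (z, a) = snocCoord z a := rfl

/-- The vector of `ℂᵐ⁺²` with null coordinates `p`, `q` in place of the last two, that is
`(z, (p - q) / 2, (p + q) / 2)`. -/
def nullCLM (m : ℕ) : CVec m × ℂ × ℂ →L[ℝ] CVec (m + 2) :=
  let P : CVec m × ℂ × ℂ →L[ℝ] ℂ := ContinuousLinearMap.fst ℝ ℂ ℂ ∘L ContinuousLinearMap.snd ℝ _ _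
  let Q : CVec m × ℂ × ℂ →L[ℝ] ℂ := ContinuousLinearMap.snd ℝ ℂ ℂ ∘L ContinuousLinearMap.snd ℝ _ _
  snocCLM (m + 1) ∘L ((snocCLM m ∘L
    ((ContinuousLinearMap.fst ℝ _ _).prod ((2 : ℝ)⁻¹ • (P - Q)))).prod ((2 : ℝ)⁻¹ • (P + Q)))

theorem nullCLM_apply (z : CVec m) (p q : ℂ) :
    nullCLM m (z, p, q) = snocCoord (snocCoord z ((p - q) / 2)) ((p + q) / 2) := by
  rw [div_eq_inv_mul, div_eq_inv_mul]
  simp only [nullCLM, ContinuousLinearMap.comp_apply, ContinuousLinearMap.prod_apply, snocCLM_apply,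
    smul_apply, sub_apply, add_apply, ContinuousLinearMap.coe_fst',
    ContinuousLinearMap.coe_snd', Complex.real_smul]
  push_cast
  rfl

/-- In null coordinates the form is `(z, w) - (p q̄' + q p̄') / 2`. -/
theorem herm_nullCLM (z w : CVec m) (p q p' q' : ℂ) :
    herm (-1) (nullCLM m (z, p, q)) (nullCLM m (w, p', q'))
      = flatCLM m z w - (p * conj q' + q * conj p') / 2 := by
  rw [nullCLM_apply, nullCLM_apply, herm_snocCoord, Fin.sum_univ_castSucc, flatCLM_apply]
  simp [snocCoord, Complex.conj_ofNat]
  ring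

/-- A pair of plane curves `(U, Y)` for which `s ↦ (U(s) z, U(s) w + Y(s), U(s))`, in null coordinates
and with `Re w = |z|²`, is horizontal and has unit speed for the Hermitian form, and whose curvature
in the direction `J ∂ₛ` balances the mean curvature of the `m`-dimensional slices. -/
structure IsHorosphericalCurve (m : ℕ) (U Y : ℝ → ℂ) : Prop where
  smooth_left : ContDiff ℝ ∞ U
  smooth_right : ContDiff ℝ ∞ Y
  ne_zero : ∀ s, U s ≠ 0
  horizontal : ∀ s, deriv Y s * conj (U s) + deriv U s * conj (Y s) = 0
  unit_speed : ∀ s, deriv Y s * conj (deriv U s) + deriv U s * conj (deriv Y s) = -2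
  balance : ∀ s, -(deriv (deriv Y) s * conj (deriv U s)
      + deriv (deriv U) s * conj (deriv Y s)).im / 2
    + m * (deriv U s * conj (U s)).im / ‖U s‖ ^ 2 = 0

/-- The jet of `(s, y) ↦ (U(s) ζ(y), U(s) f(y) + Y(s), U(s))` in null coordinates, for `df = 2 (dζ, ζ)`. -/
theorem horospherical_jet {E : Type*} [NormedAddCommGroup E] [NormedSpace ℝ E]
    [FiniteDimensional ℝ E] (hdim : Module.finrank ℝ E = m)
    {U Y : ℝ → ℂ} (hUY : IsHorosphericalCurve m U Y) {ζ : E → CVec m} {f : E → ℂ} {p : E}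
    (hζ : ContDiffAt ℝ 2 ζ p) (hf : ContDiffAt ℝ 2 f p) (hre : (f p).re = ‖ζ p‖ ^ 2)
    (hdf : ∀ᶠ y in 𝓝 p, ∀ X, fderiv ℝ f y X = 2 * flatCLM m (fderiv ℝ ζ y X) (ζ y))
    (hjet : IsMinimalJet (flatCLM m) (fderiv ℝ ζ p) (fderiv ℝ (fderiv ℝ ζ) p)) (s : ℝ) :
    let g : ℝ × E → CVec (m + 2) := fun q =>
      nullCLM m (U q.1 • ζ q.2, U q.1 * f q.2 + Y q.1, U q.1)
    (∀ X, herm (-1) (fderiv ℝ g (s, p) X) (g (s, p)) = 0) ∧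
    IsMinimalJet (hermCLM (-1) (m + 1)) (fderiv ℝ g (s, p)) (fderiv ℝ (fderiv ℝ g) (s, p)) := by
  intro g
  have hg : ContDiffAt ℝ 2 g (s, p) := by
    have hU : ContDiffAt ℝ 2 (fun q : ℝ × E => U q.1) (s, p) :=
      (hUY.smooth_left.of_le (WithTop.coe_le_coe.2 le_top) : ContDiff ℝ 2 U).contDiffAt.comp _
        contDiffAt_fst
    have hY : ContDiffAt ℝ 2 (fun q : ℝ × E => Y q.1) (s, p) :=
      (hUY.smooth_right.of_le (WithTop.coe_le_coe.2 le_top) : ContDiff ℝ 2 Y).contDiffAt.comp _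
        contDiffAt_fst
    have hζ' : ContDiffAt ℝ 2 (fun q : ℝ × E => ζ q.2) (s, p) :=
      ContDiffAt.comp (s, p) hζ contDiffAt_snd
    have hf' : ContDiffAt ℝ 2 (fun q : ℝ × E => f q.2) (s, p) :=
      ContDiffAt.comp (s, p) hf contDiffAt_snd
    exact (nullCLM m).contDiff.contDiffAt.comp _ ((hU.fun_smul hζ').prodMk
      (((hU.mul hf').add hY).prodMk hU))
  have hKd : ∀ {a b : ℝ → ℂ} {a' b' : ℂ} {t : ℝ}, HasDerivAt a a' t → HasDerivAt b b' t →
      HasDerivAt (fun t => nullCLM m (a t • ζ p, a t * f p + b t, a t))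
        (nullCLM m (a' • ζ p, a' * f p + b', a')) t := fun ha hb =>
    (nullCLM m).hasFDerivAt.comp_hasDerivAt _ ((ha.smul_const (ζ p)).prodMk
      (((ha.mul_const (f p)).add hb).prodMk ha))
  obtain ⟨hs, hss⟩ := fderiv_slice_left hg
    (c' := fun t => nullCLM m (deriv U t • ζ p, deriv U t * f p + deriv Y t, deriv U t))
    (fun t => hKd (hasDerivAt_deriv_of_smooth hUY.smooth_left t).1
      (hasDerivAt_deriv_of_smooth hUY.smooth_right t).1)
    (hKd (hasDerivAt_deriv_of_smooth hUY.smooth_left s).2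
      (hasDerivAt_deriv_of_smooth hUY.smooth_right s).2)
  let T : CVec m × ℂ →L[ℝ] CVec (m + 2) :=
    nullCLM m ∘L (((ContinuousLinearMap.lsmul ℝ ℂ (U s)) ∘L ContinuousLinearMap.fst ℝ _ _).prod
      (((ContinuousLinearMap.lsmul ℝ ℂ (U s)) ∘L ContinuousLinearMap.snd ℝ _ _).prod 0))
  have hT : ∀ z w, T (z, w) = nullCLM m (U s • z, U s * w, 0) := fun z w => rfl
  have hgT : (fun y => g (s, y)) = fun y => nullCLM m (0, Y s, U s) + T (ζ y, f y) := by
    funext y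
    rw [hT, ← map_add]
    simp [g, add_comm]
  have hpair : ContDiffAt ℝ 2 (fun y => (ζ y, f y)) p := hζ.prodMk hf
  have hpd : ∀ X Y, fderiv ℝ (fun y => (ζ y, f y)) p X = (fderiv ℝ ζ p X, fderiv ℝ f p X) ∧
      fderiv ℝ (fderiv ℝ (fun y => (ζ y, f y))) p X Y
        = (fderiv ℝ (fderiv ℝ ζ) p X Y, fderiv ℝ (fderiv ℝ f) p X Y) := by
    intro X Y
    have h1 := fderiv_const_add_clm (ContinuousLinearMap.fst ℝ (CVec m) ℂ) 0 hpair X Y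
    have h2 := fderiv_const_add_clm (ContinuousLinearMap.snd ℝ (CVec m) ℂ) 0 hpair X Y
    simp only [ContinuousLinearMap.coe_fst', ContinuousLinearMap.coe_snd', zero_add] at h1 h2
    exact ⟨Prod.ext h1.1.symm h2.1.symm, Prod.ext h1.2.symm h2.2.symm⟩
  have hp : ∀ X, fderiv ℝ f p X = 2 * flatCLM m (fderiv ℝ ζ p X) (ζ p) := hdf.self_of_nhds
  have hf2 : ∀ X Y, fderiv ℝ (fderiv ℝ f) p X Y = 2 * (flatCLM m (fderiv ℝ (fderiv ℝ ζ) p X Y) (ζ p)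
      + flatCLM m (fderiv ℝ ζ p Y) (fderiv ℝ ζ p X)) := by
    intro X Y
    have e : (fun y => fderiv ℝ f y Y) =ᶠ[𝓝 p] fun y => 2 * flatCLM m (fderiv ℝ ζ y Y) (ζ y) := by
      filter_upwards [hdf] with y hy using hy Y
    have hd := ((flatCLM m).hasFDerivAt_of_bilinear (differentiableAt_fderiv_apply hζ Y).hasFDerivAt
      (hζ.differentiableAt (by norm_num)).hasFDerivAt).const_mul (2 : ℂ)
    rw [fderiv_fderiv_apply hf, e.fderiv_eq, fderiv_fderiv_apply hζ, hd.fderiv]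
    change (2 : ℂ) • (flatCLM m _ _ + flatCLM m _ _) = _
    rw [smul_eq_mul, add_comm]
    rfl
  have hr1 : ∀ X, fderiv ℝ g (s, p) (0, X)
      = nullCLM m (U s • fderiv ℝ ζ p X, U s * fderiv ℝ f p X, 0) := by
    intro X
    have h1 := (fderiv_slice_right hg X X).1
    rw [hgT] at h1
    rw [h1, (fderiv_const_add_clm T _ hpair X X).1, (hpd X X).1, hT]
  have hr2 : ∀ X Y, fderiv ℝ (fderiv ℝ g) (s, p) (0, X) (0, Y)
      = nullCLM m (U s • fderiv ℝ (fderiv ℝ ζ) p X Y, U s * fderiv ℝ (fderiv ℝ f) p X Y, 0) := by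
    intro X Y
    have h1 := (fderiv_slice_right hg X Y).2
    rw [hgT] at h1
    rw [h1, (fderiv_const_add_clm T _ hpair X Y).2, (hpd X Y).2, hT]
  have hself : U s * conj (U s) = ((‖U s‖ ^ 2 : ℝ) : ℂ) := by
    rw [Complex.mul_conj, Complex.normSq_eq_norm_sq]
  have hff : f p + conj (f p) = 2 * flatCLM m (ζ p) (ζ p) := by
    rw [Complex.add_conj, hre, flatCLM_self]
    push_cast
    ring
  have hg0 : g (s, p) = nullCLM m (U s • ζ p, U s * f p + Y s, U s) := rfl
  have hconj : ∀ X, flatCLM m (ζ p) (fderiv ℝ ζ p X) = conj (flatCLM m (fderiv ℝ ζ p X) (ζ p)) :=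
    fun X => (conj_flatCLM _ _).symm
  refine ⟨?_, isMinimalJet_prod (c := ‖U s‖) (κ := (deriv U s * conj (U s)).im) (conj_herm (-1)) hjet
    (norm_ne_zero_iff.2 (hUY.ne_zero s)) ?_ ?_ ?_ ?_ ?_ ?_ ?_⟩
  · rintro ⟨t, X⟩
    have hX : ((t, X) : ℝ × E) = t • ((1 : ℝ), (0 : E)) + ((0 : ℝ), X) := by simp
    rw [hX, map_add, map_smul, hs, hr1, hg0, herm_add_left, herm_real_smul_left, herm_nullCLM,
      herm_nullCLM, flatCLM_smul_left, flatCLM_smul_right, flatCLM_smul_left, flatCLM_smul_right, hp,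
      map_add, map_mul]
    linear_combination (-t / 2 : ℂ) * hUY.horizontal s
      - (t / 2 * deriv U s * conj (U s) : ℂ) * hff
  · rw [hs, hermCLM_apply, herm_nullCLM, flatCLM_smul_left, flatCLM_smul_right, map_add, map_mul]
    linear_combination (-1 / 2 : ℂ) * hUY.unit_speed s
      - (1 / 2 * deriv U s * conj (deriv U s) : ℂ) * hff
  · intro X
    rw [hs, hr1, hermCLM_apply, herm_nullCLM, flatCLM_smul_left, flatCLM_smul_right, hp, map_mul,
      map_mul, hconj]
    simp [Complex.conj_ofNat]
    ring
  · intro X Y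
    rw [hr1, hr1, hermCLM_apply, herm_nullCLM, flatCLM_smul_left, flatCLM_smul_right, ← mul_assoc,
      hself]
    simp
  · intro X
    rw [hss, hr1, hermCLM_apply, herm_nullCLM, flatCLM_smul_left, flatCLM_smul_right, hp, map_mul,
      map_mul, hconj]
    rw [← Complex.zero_im]
    congr 1
    simp [Complex.conj_ofNat]
    ring
  · intro X Y
    rw [hr1, hr2, hermCLM_apply, herm_nullCLM, flatCLM_smul_left, flatCLM_smul_right, ← mul_assoc,
      hself, ← Complex.im_ofReal_mul]
    simp
  · intro X
    rw [hs, hr2, hermCLM_apply, herm_nullCLM, flatCLM_smul_left, flatCLM_smul_right, hf2,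
      flatCLM_self (fderiv ℝ ζ p X)]
    have : U s * (conj (deriv U s) * flatCLM m (fderiv ℝ (fderiv ℝ ζ) p X X) (ζ p))
        - (U s * (2 * (flatCLM m (fderiv ℝ (fderiv ℝ ζ) p X X) (ζ p)
            + ((‖fderiv ℝ ζ p X‖ ^ 2 : ℝ) : ℂ))) * conj (deriv U s)
          + 0 * conj (deriv U s * f p + deriv Y s)) / 2
        = ((‖fderiv ℝ ζ p X‖ ^ 2 : ℝ) : ℂ) * -(U s * conj (deriv U s)) := by ring
    rw [this, Complex.im_ofReal_mul, Complex.ofReal_re]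
    simp
    ring
  · rw [hs, hss, hermCLM_apply, herm_nullCLM, flatCLM_smul_left, flatCLM_smul_right, hdim, map_add,
      map_mul, ← hUY.balance s]
    congr 1
    have : deriv (deriv U) s * (conj (deriv U s) * flatCLM m (ζ p) (ζ p))
        - ((deriv (deriv U) s * f p + deriv (deriv Y) s) * conj (deriv U s)
          + deriv (deriv U) s * (conj (deriv U s) * conj (f p) + conj (deriv Y s))) / 2
        = ((-1 / 2 : ℝ) : ℂ) * (deriv (deriv Y) s * conj (deriv U s)
          + deriv (deriv U) s * conj (deriv Y s)) := by
      push_cast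
      linear_combination (-1 / 2 * deriv (deriv U) s * conj (deriv U s) : ℂ) * hff
    rw [this, Complex.im_ofReal_mul]
    ring

end Horospherical

/-! ### The curve of the horospherical profile -/

section HorosphericalCurve

variable {m : ℕ} {ρ : ℝ}

theorem horosphericalProfile_pow (s : ℝ) :
    horosphericalProfile (m + 1) ρ s ^ (m + 2) = ρ ^ (m + 2) * Real.cosh ((m + 2) * s) := by
  have hk : (((m + 1 : ℕ) : ℝ) + 1) = ((m + 2 : ℕ) : ℝ) := by push_cast; ring
  rw [horosphericalProfile, mul_pow, hk, one_div,
    Real.rpow_inv_natCast_pow (Real.cosh_pos _).le (by omega)]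
  push_cast
  rfl

theorem hasDerivAt_horosphericalProfile (s : ℝ) :
    HasDerivAt (horosphericalProfile (m + 1) ρ)
      (horosphericalProfile (m + 1) ρ s * (Real.sinh ((m + 2) * s) / Real.cosh ((m + 2) * s))) s := by
  have hk : (((m + 1 : ℕ) : ℝ) + 1) = m + 2 := by push_cast; ring
  have hk0 : (m : ℝ) + 2 ≠ 0 := by positivity
  have h1 : HasDerivAt (fun s => Real.cosh ((m + 2 : ℝ) * s))
      (Real.sinh ((m + 2 : ℝ) * s) * (m + 2)) s := by
    simpa using ((hasDerivAt_id s).const_mul (m + 2 : ℝ)).cosh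
  have hc := Real.cosh_pos ((m + 2 : ℝ) * s)
  have h2 := (h1.rpow_const (p := 1 / ((m : ℝ) + 2)) (Or.inl hc.ne')).const_mul ρ
  have e : horosphericalProfile (m + 1) ρ
      = fun s => ρ * Real.cosh ((m + 2 : ℝ) * s) ^ (1 / ((m : ℝ) + 2)) := by
    funext s
    rw [horosphericalProfile, hk]
  rw [e]
  refine h2.congr_deriv ?_
  rw [Real.rpow_sub_one hc.ne']
  field_simp

theorem contDiff_horosphericalProfile : ContDiff ℝ ∞ (horosphericalProfile (m + 1) ρ) :=
  contDiff_const.mul ((Real.contDiff_cosh.comp (contDiff_const.mul contDiff_id)).rpow_const_of_ne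
    fun _ => (Real.cosh_pos _).ne')

/-- With `χ = tanh((m + 2)s) + i / cosh((m + 2)s)`, a unit vector, `y = 1 / r - 2 i r a A_{m+4}` and
`θ = a A_{m+2}`, one has `(r e^{iθ})' = r χ e^{iθ}` and `(y e^{iθ})' = -χ ȳ e^{iθ}`. -/
theorem isHorosphericalCurve (hρ : 0 < ρ) :
    IsHorosphericalCurve m
      (fun s => horosphericalProfile (m + 1) ρ s * Complex.exp
        ((ρ ^ (m + 2) * horosphericalIntegral (m + 1) ρ (m + 2) s : ℝ) * Complex.I))
      (fun s => (1 / horosphericalProfile (m + 1) ρ s - 2 * Complex.I *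
        horosphericalProfile (m + 1) ρ s *
          (ρ ^ (m + 2) * horosphericalIntegral (m + 1) ρ (m + 4) s : ℝ)) * Complex.exp
        ((ρ ^ (m + 2) * horosphericalIntegral (m + 1) ρ (m + 2) s : ℝ) * Complex.I)) := by
  have hRs := contDiff_horosphericalProfile (m := m) (ρ := ρ)
  have hRd := hasDerivAt_horosphericalProfile (m := m) (ρ := ρ)
  have hRp := horosphericalProfile_pos (m + 1) hρ
  have hRk := horosphericalProfile_pow (m := m) (ρ := ρ)
  unfold horosphericalIntegral
  generalize horosphericalProfile (m + 1) ρ = R at *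
  have hinv : ∀ k : ℕ, ContDiff ℝ ∞ fun s => 1 / R s ^ k := fun k =>
    contDiff_const.div (hRs.pow k) fun s => pow_ne_zero _ (hRp s).ne'
  obtain ⟨dθ, hθ⟩ := contDiff_integral (hinv (m + 2)) (ρ ^ (m + 2))
  obtain ⟨dB, hB⟩ := contDiff_integral (hinv (m + 4)) (ρ ^ (m + 2))
  obtain ⟨θ, eθ⟩ : ∃ θ : ℝ → ℝ, ∀ s, ρ ^ (m + 2) * ∫ t in (0 : ℝ)..s, 1 / R t ^ (m + 2) = θ s :=
    ⟨_, fun _ => rfl⟩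
  obtain ⟨B, eB⟩ : ∃ B : ℝ → ℝ, ∀ s, ρ ^ (m + 2) * ∫ t in (0 : ℝ)..s, 1 / R t ^ (m + 4) = B s :=
    ⟨_, fun _ => rfl⟩
  simp only [eθ] at dθ hθ ⊢
  simp only [eB] at dB hB ⊢
  obtain ⟨T, hT⟩ : ∃ T : ℝ → ℝ,
      T = fun s => Real.sinh ((m + 2) * s) / Real.cosh ((m + 2) * s) := ⟨_, rfl⟩
  obtain ⟨c, hc⟩ : ∃ c : ℝ → ℝ, c = fun s => 1 / Real.cosh ((m + 2) * s) := ⟨_, rfl⟩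
  have hcosh := fun s : ℝ => (Real.cosh_pos ((m + 2) * s)).ne'
  have hRc : ∀ s, (R s : ℂ) ≠ 0 := fun s => by exact_mod_cast (hRp s).ne'
  have dθ' : ∀ s, HasDerivAt θ (c s) s := fun s => by
    refine (dθ s).congr_deriv ?_
    rw [hRk, hc]
    have := hcosh s
    field_simp
  have dB' : ∀ s, HasDerivAt B (c s / R s ^ 2) s := fun s => by
    refine (dB s).congr_deriv ?_
    rw [show R s ^ (m + 4) = R s ^ (m + 2) * R s ^ 2 by ring, hRk, hc]
    have := hcosh s
    have := (hRp s).ne'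
    field_simp
  have dR : ∀ s, HasDerivAt R (R s * T s) s := fun s => by
    rw [hT]
    exact hRd s
  have dC : ∀ s : ℝ, HasDerivAt (fun s => Real.cosh ((m + 2 : ℝ) * s))
      (Real.sinh ((m + 2 : ℝ) * s) * (m + 2)) s := fun s => by
    simpa using ((hasDerivAt_id s).const_mul (m + 2 : ℝ)).cosh
  have dS : ∀ s : ℝ, HasDerivAt (fun s => Real.sinh ((m + 2 : ℝ) * s))
      (Real.cosh ((m + 2 : ℝ) * s) * (m + 2)) s := fun s => by
    simpa using ((hasDerivAt_id s).const_mul (m + 2 : ℝ)).sinh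
  have dc : ∀ s, HasDerivAt c (-((m + 2) * c s * T s)) s := fun s => by
    rw [hc, hT]
    refine ((hasDerivAt_const s (1 : ℝ)).div (dC s) (hcosh s)).congr_deriv ?_
    have := hcosh s
    field_simp
    ring
  have dT : ∀ s, HasDerivAt T ((m + 2) * c s ^ 2) s := fun s => by
    rw [hc, hT]
    refine ((dS s).div (dC s) (hcosh s)).congr_deriv ?_
    have := hcosh s
    field_simp
    linear_combination Real.cosh_sq ((m + 2) * s)
  have hunit : ∀ s, T s ^ 2 + c s ^ 2 = 1 := fun s => by
    rw [hc, hT]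
    have := hcosh s
    field_simp
    linear_combination -Real.cosh_sq ((m + 2) * s)
  have de : ∀ s, HasDerivAt (fun s => Complex.exp (θ s * Complex.I))
      (Complex.exp (θ s * Complex.I) * (c s * Complex.I)) s := fun s =>
    ((dθ' s).ofReal_comp.mul_const Complex.I).cexp
  have dχ : ∀ s, HasDerivAt (fun s => (T s + c s * Complex.I : ℂ))
      (-((m + 2) * c s * Complex.I * (T s + c s * Complex.I))) s := fun s => by
    refine ((dT s).ofReal_comp.add ((dc s).ofReal_comp.mul_const Complex.I)).congr_deriv ?_
    push_cast
    linear_combination (m + 2) * c s ^ 2 * Complex.I_sq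
  have dU : ∀ s, HasDerivAt (fun s => (R s : ℂ) * Complex.exp (θ s * Complex.I))
      (R s * (T s + c s * Complex.I) * Complex.exp (θ s * Complex.I)) s := fun s => by
    refine ((dR s).ofReal_comp.mul (de s)).congr_deriv ?_
    push_cast
    ring
  have dU' : ∀ s, HasDerivAt
      (fun s => R s * (T s + c s * Complex.I) * Complex.exp (θ s * Complex.I))
      (R s * (T s + c s * Complex.I) * (T s + c s * Complex.I - (m + 2) * c s * Complex.I)
        * Complex.exp (θ s * Complex.I)) s := fun s => by
    refine (((dR s).ofReal_comp.mul (dχ s)).mul (de s)).congr_deriv ?_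
    simp only [Pi.mul_apply]
    push_cast
    ring
  have dy : ∀ (j : ℂ) (s : ℝ), HasDerivAt (fun s => (1 / R s + 2 * j * R s * B s : ℂ))
      (-T s / R s + 2 * j * (R s * T s * B s + c s / R s)) s := fun j s => by
    have h1 := (hasDerivAt_const s (1 : ℂ)).div (dR s).ofReal_comp (hRc s)
    have h2 := (((dR s).ofReal_comp.const_mul (2 * j)).mul (dB' s).ofReal_comp)
    refine (h1.add h2).congr_deriv ?_
    have := hRc s
    push_cast
    field_simp
    ring
  have dY : ∀ s, HasDerivAt
      (fun s => (1 / R s - 2 * Complex.I * R s * B s) * Complex.exp (θ s * Complex.I))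
      (-((T s + c s * Complex.I) * (1 / R s + 2 * Complex.I * R s * B s))
        * Complex.exp (θ s * Complex.I)) s := fun s => by
    have h1 := (dy (-Complex.I) s).mul (de s)
    have e : (fun s => (1 / R s - 2 * Complex.I * R s * B s : ℂ))
        = fun s => (1 / R s + 2 * (-Complex.I) * R s * B s : ℂ) := by
      funext s
      ring
    have e' : (fun s => (1 / R s - 2 * Complex.I * R s * B s) * Complex.exp (θ s * Complex.I))
        = (fun s => (1 / R s + 2 * (-Complex.I) * R s * B s : ℂ))
          * fun s => Complex.exp (θ s * Complex.I) := by
      rw [← e]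
      rfl
    rw [e']
    refine h1.congr_deriv ?_
    have := hRc s
    field_simp
    ring
  have dY' : ∀ s, HasDerivAt
      (fun s => -((T s + c s * Complex.I) * (1 / R s + 2 * Complex.I * R s * B s))
        * Complex.exp (θ s * Complex.I))
      (-((T s + c s * Complex.I) * (-((m + 1) * c s * Complex.I)
          * (1 / R s + 2 * Complex.I * R s * B s)
          + (-T s / R s + 2 * Complex.I * (R s * T s * B s + c s / R s))))
        * Complex.exp (θ s * Complex.I)) s := fun s => by
    refine ((((dχ s).mul (dy Complex.I s)).neg).mul (de s)).congr_deriv ?_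
    simp only [Pi.mul_apply, Pi.neg_apply]
    ring
  have hU1 := funext fun s => (dU s).deriv
  have hY1 := funext fun s => (dY s).deriv
  have hexp : ContDiff ℝ ∞ fun s => Complex.exp (θ s * Complex.I) :=
    ((Complex.ofRealCLM.contDiff.comp hθ).mul contDiff_const).cexp
  have hRC : ContDiff ℝ ∞ fun s => (R s : ℂ) := Complex.ofRealCLM.contDiff.comp hRs
  have hRinv : ContDiff ℝ ∞ fun s => (1 / R s : ℂ) := by
    have := Complex.ofRealCLM.contDiff.comp (hinv 1)
    simpa [Function.comp_def] using this
  refine ⟨hRC.mul hexp, (hRinv.sub ((contDiff_const.mul hRC).mul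
    (Complex.ofRealCLM.contDiff.comp hB))).mul hexp,
    fun s => mul_ne_zero (hRc s) (Complex.exp_ne_zero _), fun s => ?_, fun s => ?_, fun s => ?_⟩
  · rw [(dU s).deriv, (dY s).deriv, mul_exp_mul_conj, mul_exp_mul_conj]
    have := hRc s
    simp only [map_mul, map_sub, map_div₀, map_one, Complex.conj_ofReal, Complex.conj_I,
      Complex.conj_ofNat]
    field_simp
    ring
  · rw [(dU s).deriv, (dY s).deriv, mul_exp_mul_conj, mul_exp_mul_conj]
    have hu : (T s : ℂ) ^ 2 + (c s : ℂ) ^ 2 = 1 := by exact_mod_cast hunit s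
    have := hRc s
    simp [Complex.conj_ofNat]
    field_simp
    linear_combination (-2 : ℂ) * hu + 2 * c s ^ 2 * Complex.I_sq
  · have hnorm : ‖(R s : ℂ) * Complex.exp ((θ s : ℝ) * Complex.I)‖ ^ 2 = R s ^ 2 := by
      rw [norm_mul, Complex.norm_exp_ofReal_mul_I, mul_one, Complex.norm_real, Real.norm_eq_abs,
        sq_abs]
    rw [hU1, hY1, (dU' s).deriv, (dY' s).deriv, hnorm, mul_exp_mul_conj, mul_exp_mul_conj,
      mul_exp_mul_conj]
    have hu : (T s : ℂ) ^ 2 + (c s : ℂ) ^ 2 = 1 := by exact_mod_cast hunit s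
    have hχ : (T s + c s * Complex.I : ℂ) * (T s - c s * Complex.I) = 1 := by
      linear_combination hu - (c s : ℂ) ^ 2 * Complex.I_sq
    have hR := hRc s
    have hsum : (-R s : ℂ) * (-((m + 1) * c s * Complex.I)
          * (1 / R s + 2 * Complex.I * R s * B s)
          + (-T s / R s + 2 * Complex.I * (R s * T s * B s + c s / R s))
          + (T s + c s * Complex.I - (m + 2) * c s * Complex.I)
            * (1 / R s - 2 * Complex.I * R s * B s)) = ((2 * m * c s : ℝ) : ℂ) * Complex.I := by
      push_cast
      field_simp
      ring
    have key : -((T s + c s * Complex.I) * (-((m + 1) * c s * Complex.I)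
          * (1 / R s + 2 * Complex.I * R s * B s)
          + (-T s / R s + 2 * Complex.I * (R s * T s * B s + c s / R s))))
          * conj (R s * (T s + c s * Complex.I) : ℂ)
        + R s * (T s + c s * Complex.I) * (T s + c s * Complex.I - (m + 2) * c s * Complex.I)
          * conj (-((T s + c s * Complex.I) * (1 / R s + 2 * Complex.I * R s * B s)) : ℂ)
        = ((2 * m * c s : ℝ) : ℂ) * Complex.I := by
      simp only [map_mul, map_add, map_neg, map_div₀, map_one, Complex.conj_ofReal, Complex.conj_I,
        Complex.conj_ofNat]
      linear_combination hsum + (-R s * (-((m + 1) * c s * Complex.I)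
          * (1 / R s + 2 * Complex.I * R s * B s)
          + (-T s / R s + 2 * Complex.I * (R s * T s * B s + c s / R s))
          + (T s + c s * Complex.I - (m + 2) * c s * Complex.I)
            * (1 / R s - 2 * Complex.I * R s * B s)) : ℂ) * hχ
    rw [key]
    have hR' := (hRp s).ne'
    simp
    field_simp
    ring

end HorosphericalCurve

/-! ### The three families of immersions -/

theorem herm_one_eq_sum {m : ℕ} (z w : CVec (m + 1)) :
    herm 1 z w = ∑ i, z i * conj (w i) := by
  rw [herm, Fin.sum_univ_castSucc, Complex.ofReal_one, one_mul]

/-- `(z, a) ↦ (a, z)` as a linear map. -/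
def consCLM (n : ℕ) : CVec n × ℂ →L[ℝ] CVec (n + 1) :=
  LinearMap.toContinuousLinearMap
    { toFun := fun q => consCoord q.2 q.1
      map_add' := fun p q => by
        ext i
        induction i using Fin.cases <;> simp [consCoord]
      map_smul' := fun c p => by
        ext i
        induction i using Fin.cases <;> simp [consCoord] }

theorem consCLM_apply {n : ℕ} (z : CVec n) (a : ℂ) : consCLM n (z, a) = consCoord a z := rfl

/-- In null coordinates the lift of `Υ` is `(U η, U w + Y, U)`. -/
theorem UpsilonVec_eq_nullCLM (m : ℕ) {ρ : ℝ} (hρ : 0 < ρ) (s : ℝ) (η : CVec m) (w : ℂ) :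
    UpsilonVec m ρ s η w =
      let e := Complex.exp
        ((ρ ^ (m + 2) * horosphericalIntegral (m + 1) ρ (m + 2) s : ℝ) * Complex.I)
      let U := horosphericalProfile (m + 1) ρ s * e
      nullCLM m (U • η, U * w + (1 / horosphericalProfile (m + 1) ρ s - 2 * Complex.I *
        horosphericalProfile (m + 1) ρ s *
          (ρ ^ (m + 2) * horosphericalIntegral (m + 1) ρ (m + 4) s : ℝ)) * e, U) := by
  have hR : (horosphericalProfile (m + 1) ρ s : ℂ) ≠ 0 := by
    exact_mod_cast (horosphericalProfile_pos (m + 1) hρ s).ne'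
  dsimp only
  rw [UpsilonVec, nullCLM_apply, ← snocCoord_smul, ← snocCoord_smul, smul_smul]
  congr 1
  · congr 1
    · rw [mul_comm]
    · field_simp
      ring
  · field_simp
    ring

variable {m : ℕ} {N : Type*} [TopologicalSpace N] [ChartedSpace (EuclideanSpace ℝ (Fin m)) N]

theorem contMDiff_nullCLM {U Y : ℝ → ℂ} (hU : ContDiff ℝ ∞ U) (hY : ContDiff ℝ ∞ Y)
    {η : N → CVec m} (hη : ContMDiff (𝓡 m) 𝓘(ℝ, CVec m) ∞ η) {f : N → ℂ}
    (hf : ContMDiff (𝓡 m) 𝓘(ℝ, ℂ) ∞ f) :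
    ContMDiff (𝓘(ℝ, ℝ).prod (𝓡 m)) 𝓘(ℝ, CVec (m + 2)) ∞ fun q : ℝ × N =>
      nullCLM m (U q.1 • η q.2, U q.1 * f q.2 + Y q.1, U q.1) := by
  have hU' : ContMDiff (𝓘(ℝ, ℝ).prod (𝓡 m)) 𝓘(ℝ, ℂ) ∞ fun q : ℝ × N => U q.1 :=
    hU.contMDiff.comp contMDiff_fst
  have hY' : ContMDiff (𝓘(ℝ, ℝ).prod (𝓡 m)) 𝓘(ℝ, ℂ) ∞ fun q : ℝ × N => Y q.1 :=
    hY.contMDiff.comp contMDiff_fst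
  have hη' : ContMDiff (𝓘(ℝ, ℝ).prod (𝓡 m)) 𝓘(ℝ, CVec m) ∞ fun q : ℝ × N => η q.2 :=
    hη.comp contMDiff_snd
  have hf' : ContMDiff (𝓘(ℝ, ℝ).prod (𝓡 m)) 𝓘(ℝ, ℂ) ∞ fun q : ℝ × N => f q.2 :=
    hf.comp contMDiff_snd
  have hp : ContMDiff (𝓘(ℝ, ℝ).prod (𝓡 m)) 𝓘(ℝ, (ℂ × ℂ) × CVec m × ℂ) ∞ fun q : ℝ × N =>
      ((U q.1, Y q.1), (η q.2, f q.2)) :=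
    (hU'.prodMk_space hY').prodMk_space (hη'.prodMk_space hf')
  have hΘ : ContDiff ℝ ∞ fun w : (ℂ × ℂ) × CVec m × ℂ =>
      (w.1.1 • w.2.1, w.1.1 * w.2.2 + w.1.2, w.1.1) := by
    fun_prop
  have h2 : ContDiff ℝ ∞ fun w : (ℂ × ℂ) × CVec m × ℂ =>
      nullCLM m (w.1.1 • w.2.1, w.1.1 * w.2.2 + w.1.2, w.1.1) :=
    (nullCLM m).contDiff.comp hΘ
  have h3 := h2.contMDiff.comp hp
  exact h3

variable [IsManifold (𝓡 m) ∞ N] {ρ : ℝ} {r : ℝ → ℝ}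

theorem isMinimalLagrangian_Phi (hρ : 0 < ρ) (hr : IsSphericalProfile (m + 1) ρ r) {φ : N → CP m}
    (hφ : IsMinimalLagrangian (𝓡 m) φ) {φl : N → Quadric 1 m} (hl : IsHorizontalLift (𝓡 m) φl φ) :
    IsMinimalLagrangian (𝓘(ℝ, ℝ).prod (𝓡 m)) (Phi m ρ r φl) := by
  have huv := isProfileCurve_of_ode (m := m) (ε := 1) (σ := Real.sinh) (τ := Real.cosh) (ρ := ρ)
    (r := r) (Or.inl rfl) Real.contDiff_sinh Real.contDiff_cosh Real.hasDerivAt_sinh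
    Real.hasDerivAt_cosh (fun x => by rw [Real.cosh_sq]; ring) hr.differentiable
    hr.differentiable_deriv (fun s => by
      have := hr.equation s
      push_cast at this
      rw [← this]
      ring) hr.init hr.deriv_init (Real.sinh_pos_iff.2 hρ).ne' (Real.cosh_pos ρ).ne'
  refine isMinimalLagrangian_join (Or.inl rfl) (by simp) (J := snocCLM (m + 1))
    (fun z w a b => ?_) huv hφ hl (fun q => ?_)
  · rw [snocCLM_apply, snocCLM_apply, herm_snocCoord, herm_one_eq_sum]
    push_cast
    ring
  · simp only [snocCLM_apply, PhiVec, Real.tanh_eq_sinh_div_cosh]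

theorem isMinimalLagrangian_Psi (hρ : 0 < ρ) (hr : IsHyperbolicProfile (m + 1) ρ r) {ψ : N → CH m}
    (hψ : IsMinimalLagrangian (𝓡 m) ψ) {ψl : N → Quadric (-1) m}
    (hl : IsHorizontalLift (𝓡 m) ψl ψ) :
    IsMinimalLagrangian (𝓘(ℝ, ℝ).prod (𝓡 m)) (Psi m ρ r ψl) := by
  have huv := isProfileCurve_of_ode (m := m) (ε := -1) (σ := Real.cosh) (τ := Real.sinh) (ρ := ρ)
    (r := r) (Or.inr rfl) Real.contDiff_cosh Real.contDiff_sinh Real.hasDerivAt_cosh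
    Real.hasDerivAt_sinh (fun x => by rw [Real.cosh_sq]; ring) hr.differentiable
    hr.differentiable_deriv (fun s => by
      have := hr.equation s
      push_cast at this
      rw [← this]
      ring) hr.init hr.deriv_init (Real.cosh_pos ρ).ne' (Real.sinh_pos_iff.2 hρ).ne'
  refine isMinimalLagrangian_join (Or.inr rfl) (by simp) (J := consCLM (m + 1))
    (fun z w a b => ?_) huv hψ hl (fun q => ?_)
  · rw [consCLM_apply, consCLM_apply, herm_consCoord]
    push_cast
    ring
  · simp only [consCLM_apply, PsiVec]

theorem isMinimalLagrangian_Upsilon (hρ : 0 < ρ) {η : N → CVec m}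
    (hη : IsMinimalLagrangianFlat (𝓡 m) η) {f : N → ℂ} (hf : MDifferentiable (𝓡 m) 𝓘(ℝ, ℂ) f)
    (hre : ∀ x, (f x).re = ‖η x‖ ^ 2)
    (him : ∀ (x : N) (v : TangentSpace (𝓡 m) x),
      mfderiv (𝓡 m) 𝓘(ℝ, ℝ) (fun y => (f y).im) x v
        = 2 * flatMetric (η x) (mfderiv (𝓡 m) 𝓘(ℝ, CVec m) η x v) (Complex.I • η x)) :
    IsMinimalLagrangian (𝓘(ℝ, ℝ).prod (𝓡 m)) (Upsilon m hρ η f hre) := by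
  have hηs : ContMDiff (𝓡 m) 𝓘(ℝ, CVec m) ∞ η := fun x => (hη x).smooth
  have hdf := fun x : N => fun y hy X => fderiv_potential (x := x) (y := y) hηs hf hre him hy X
  have hfs := contMDiff_potential hηs hf hdf
  have hUY := isHorosphericalCurve (m := m) hρ
  refine isMinimalLagrangian_of_prod_chart ?_ (by simp) fun s x => ?_
  · simp only [UpsilonVec_eq_nullCLM m hρ]
    exact contMDiff_nullCLM hUY.smooth_left hUY.smooth_right hηs hfs
  · simp only [UpsilonVec_eq_nullCLM m hρ]
    have hjet := isMinimalJet_of_flat (hη x)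
    refine horospherical_jet (by simp) hUY
      ((contMDiffAt_iff_chart.1 (hηs x)).2.of_le (WithTop.coe_le_coe.2 le_top))
      ((contMDiffAt_iff_chart.1 (hfs x)).2.of_le (WithTop.coe_le_coe.2 le_top)) (hre _) ?_ hjet s
    filter_upwards [eventually_mem_target (I := 𝓡 m) x] with y hy using hdf x y hy

end MinLag

end

theorem proposition3 (m : ℕ) (N : Type*) [TopologicalSpace N]
    [ChartedSpace (EuclideanSpace ℝ (Fin m)) N] [IsManifold (𝓡 m) ∞ N] [SimplyConnectedSpace N] :
    (∀ (ρ : ℝ) (_ : 0 < ρ) (r : ℝ → ℝ) (_ : MinLag.IsSphericalProfile (m + 1) ρ r)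
        (φ : N → MinLag.CP m) (_ : MinLag.IsMinimalLagrangian (𝓡 m) φ)
        (φl : N → MinLag.Quadric 1 m) (_ : MinLag.IsHorizontalLift (𝓡 m) φl φ),
        MinLag.IsMinimalLagrangian (𝓘(ℝ, ℝ).prod (𝓡 m)) (MinLag.Phi m ρ r φl)) ∧
    (∀ (ρ : ℝ) (_ : 0 < ρ) (r : ℝ → ℝ) (_ : MinLag.IsHyperbolicProfile (m + 1) ρ r)
        (ψ : N → MinLag.CH m) (_ : MinLag.IsMinimalLagrangian (𝓡 m) ψ)
        (ψl : N → MinLag.Quadric (-1) m) (_ : MinLag.IsHorizontalLift (𝓡 m) ψl ψ),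
        MinLag.IsMinimalLagrangian (𝓘(ℝ, ℝ).prod (𝓡 m)) (MinLag.Psi m ρ r ψl)) ∧
    (∀ (ρ : ℝ) (hρ : 0 < ρ) (η : N → MinLag.CVec m)
        (_ : MinLag.IsMinimalLagrangianFlat (𝓡 m) η)
        (f : N → ℂ) (_ : MDifferentiable (𝓡 m) 𝓘(ℝ, ℂ) f)
        (hf : ∀ x, (f x).re = ‖η x‖ ^ 2)
        (_ : ∀ (x : N) (v : TangentSpace (𝓡 m) x),
          mfderiv (𝓡 m) 𝓘(ℝ, ℝ) (fun y => (f y).im) x v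
            = 2 * MinLag.flatMetric (η x) (mfderiv (𝓡 m) 𝓘(ℝ, MinLag.CVec m) η x v)
                (Complex.I • η x)),
        MinLag.IsMinimalLagrangian (𝓘(ℝ, ℝ).prod (𝓡 m)) (MinLag.Upsilon m hρ η f hf)) := by
  exact ⟨fun _ hρ _ hr _ hφ _ hl => MinLag.isMinimalLagrangian_Phi hρ hr hφ hl,
    fun _ hρ _ hr _ hψ _ hl => MinLag.isMinimalLagrangian_Psi hρ hr hψ hl,
    fun _ hρ _ hη _ hf hre him => MinLag.isMinimalLagrangian_Upsilon hρ hη hf hre him⟩
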